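/- Let $G$ be a group (for instance a finite group or a compact Lie group) and let $g\mapsto U(g)$ be a unitary representation of $G$ on a finite-dimensional complex Hilbert space $\mathcal H$. Let $\mathcal V^G=\{V \text{ unitary on } \mathcal H : VU(g)=U(g)V \text{ for all } g\in G\}$ be the group of $G$-invariant unitaries and let $\mathcal{SV}^G=[\mathcal V^G,\mathcal V^G]$ be its commutator subgroup, i.e. the subgroup generated by all $WVW^{-1}V^{-1}$ with $V,W\in\mathcal V^G$. Let $\mathcal H=\bigoplus_{\lambda\in\Lambda}\mathcal Q_\lambda\otimes\mathcal M_\lambda$ be the isotypic decomposition, where $\Lambda$ is the set of equivalence classes of irreducible representations (irreps) of $G$ occurring in $U$, $G$ acts on $\mathcal Q_\lambda$ by the irrep $\lambda$, and $\mathcal M_\lambda$ is the multiplicity space of $\lambda$, with $\dim\mathcal M_\lambda\ge 1$ the multiplicity of $\lambda$ in $U$. (Concretely, $\mathcal M_\lambda$ may be taken to be the space of $G$-intertwining maps $f:\mathcal Q_\lambda\to\mathcal H$ with $\langle f,f'\rangle=\operatorname{Tr}(f^\dagger f')/\dim\mathcal Q_\lambda$, where $q\otimes f$ corresponds to $f(q)$.)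 Every $V\in\mathcal V^G$ has the form $V=\bigoplus_{\lambda}\mathbb I_{\mathcal Q_\lambda}\otimes\pi_\lambda(V)$, which defines homomorphisms $\pi_\lambda:\mathcal V^G\to \mathrm U(\mathcal M_\lambda)$ (concretely, $\pi_\lambda(V)f=V\circ f$). Let $\mathcal T\subseteq\mathcal V^G$ be an arbitrary subgroup. Then $\mathcal{SV}^G\subseteq\mathcal T$ if and only if the following two conditions both hold: **A.** For every $\lambda\in\Lambda$, $\mathrm{SU}(\mathcal M_\lambda)\subseteq\pi_\lambda(\mathcal T)=\{\pi_\lambda(V):V\in\mathcal T\}$. **B.** For every pair of distinct $\lambda_1,\lambda_2\in\Lambda$ with $\dim\mathcal M_{\lambda_1}=\dim\mathcal M_{\lambda_2}\ge 2$, there exists $V\in\mathcal T$ with $|\operatorname{Tr}\pi_{\lambda_1}(V)|\neq|\operatorname{Tr}\pi_{\lambda_2}(V)|$. -/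

import Mathlib

open scoped InnerProductSpace

noncomputable section

namespace SymmetricUnitaries

section Setup

variable {G : Type*} [Group G] {H : Type*} [NormedAddCommGroup H] [InnerProductSpace ℂ H]

/-- A unitary representation `U` of `G` on the Hilbert space `H` is a homomorphism from `G` to the
group `H ≃ₗᵢ[ℂ] H` of unitaries of `H`. This is the underlying linear representation. -/
def linRep (U : G →* (H ≃ₗᵢ[ℂ] H)) : Representation ℂ G H where
  toFun g := (U g).toLinearEquiv.toLinearMap
  map_one' := by ext; simp
  map_mul' a b := by ext; simp

@[simp] lemma linRep_apply (U : G →* (H ≃ₗᵢ[ℂ] H)) (g : G) (x : H) : linRep U g x = U g x := rfl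

/-- The group `𝒱^G` of `G`-invariant unitaries: the unitaries that commute with every `U g`. -/
def invariantUnitaries (U : G →* (H ≃ₗᵢ[ℂ] H)) : Subgroup (H ≃ₗᵢ[ℂ] H) where
  carrier := {V | ∀ g : G, V * U g = U g * V}
  one_mem' g := by simp
  mul_mem' {V W} hV hW g := by rw [mul_assoc, hW g, ← mul_assoc, hV g, mul_assoc]
  inv_mem' {V} hV g := by
    rw [inv_mul_eq_iff_eq_mul, ← mul_assoc, hV g, mul_assoc, mul_inv_cancel, mul_one]

/-- The irreducible subrepresentations of `U`. -/
def IrredSubrep (U : G →* (H ≃ₗᵢ[ℂ] H)) : Type _ :=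
  {W : Subrepresentation (linRep U) // W.toRepresentation.IsIrreducible}

/-- Equivalence (isomorphism) of irreducible subrepresentations. -/
instance irredSetoid (U : G →* (H ≃ₗᵢ[ℂ] H)) : Setoid (IrredSubrep U) where
  r W₁ W₂ := Nonempty (W₁.1.toRepresentation.Equiv W₂.1.toRepresentation)
  iseqv := ⟨fun _ => ⟨.refl _⟩, fun ⟨e⟩ => ⟨e.symm⟩, fun ⟨e⟩ ⟨f⟩ => ⟨e.trans f⟩⟩

/-- The set `Λ` of (equivalence classes of) irreps of `G` that occur in `U`. -/
def Irreps (U : G →* (H ≃ₗᵢ[ℂ] H)) : Type _ := Quotient (irredSetoid U)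

/-- A subrepresentation of `U` in the class `l`, chosen as the irrep space `𝒬_l`. -/
def irrepSubrep (U : G →* (H ≃ₗᵢ[ℂ] H)) (l : Irreps U) : Subrepresentation (linRep U) :=
  (Quotient.out l).1

/-- The space `𝒬_l` carrying the irrep `l`, with the inner product induced from `H`. -/
abbrev IrrepSpace (U : G →* (H ≃ₗᵢ[ℂ] H)) (l : Irreps U) : Type _ := (irrepSubrep U l).toSubmodule

instance irrepSubrep_isIrreducible (U : G →* (H ≃ₗᵢ[ℂ] H)) (l : Irreps U) :
    (irrepSubrep U l).toRepresentation.IsIrreducible := (Quotient.out l).2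

/-- The multiplicity space `ℳ_l`, realised as the space `Hom_G(𝒬_l, H)` of intertwining maps.
The isotypic component of `l` is `𝒬_l ⊗ ℳ_l` through `q ⊗ f ↦ f q`. -/
def MultSpace (U : G →* (H ≃ₗᵢ[ℂ] H)) (l : Irreps U) : Type _ :=
  Representation.IntertwiningMap (irrepSubrep U l).toRepresentation (linRep U)

variable {U : G →* (H ≃ₗᵢ[ℂ] H)} {l : Irreps U}

instance : AddCommGroup (MultSpace U l) :=
  inferInstanceAs (AddCommGroup (Representation.IntertwiningMap _ (linRep U)))

instance : Module ℂ (MultSpace U l) :=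
  inferInstanceAs (Module ℂ (Representation.IntertwiningMap _ (linRep U)))

/-- The linear map `𝒬_l → H` underlying an element of `ℳ_l`. -/
def MultSpace.toLin : MultSpace U l →ₗ[ℂ] (IrrepSpace U l →ₗ[ℂ] H) where
  toFun f := Representation.IntertwiningMap.toLinearMap f
  map_add' _ _ := rfl
  map_smul' _ _ := rfl

lemma MultSpace.toLin_injective :
    Function.Injective (MultSpace.toLin : MultSpace U l →ₗ[ℂ] (IrrepSpace U l →ₗ[ℂ] H)) :=
  fun _ _ h => Representation.IntertwiningMap.ext h

lemma MultSpace.toLin_intertwines (f : MultSpace U l) (g : G) (q : IrrepSpace U l) :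
    f.toLin ((irrepSubrep U l).toRepresentation g q) = U g (f.toLin q) :=
  Representation.IntertwiningMap.isIntertwining _ _ f g q

instance : Nontrivial (IrrepSpace U l) := by
  by_contra h
  rw [not_nontrivial_iff_subsingleton] at h
  apply bot_ne_top (α := Subrepresentation (irrepSubrep U l).toRepresentation)
  apply Subrepresentation.toSubmodule_injective
  exact Subsingleton.elim _ _

/-- Composition `f ↦ V ∘ f` on `ℳ_l` with a `G`-invariant unitary `V`. -/
def multAct (V : invariantUnitaries U) (l : Irreps U) : MultSpace U l →ₗ[ℂ] MultSpace U l where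
  toFun f := ⟨(V : H ≃ₗᵢ[ℂ] H).toLinearEquiv.toLinearMap ∘ₗ f.toLin, fun g => by
    ext q
    simp only [LinearMap.comp_apply, f.toLin_intertwines]
    exact DFunLike.congr_fun (V.2 g) (f.toLin q)⟩
  map_add' f₁ f₂ := MultSpace.toLin_injective <| by
    ext q; exact map_add (V : H ≃ₗᵢ[ℂ] H) (f₁.toLin q) (f₂.toLin q)
  map_smul' c f := MultSpace.toLin_injective <| by
    ext q; exact map_smul (V : H ≃ₗᵢ[ℂ] H) c (f.toLin q)

lemma multAct_toLin (V : invariantUnitaries U) (f : MultSpace U l) (q : IrrepSpace U l) :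
    (multAct V l f).toLin q = (V : H ≃ₗᵢ[ℂ] H) (f.toLin q) := rfl

variable [FiniteDimensional ℂ H]

instance : FiniteDimensional ℂ (MultSpace U l) :=
  FiniteDimensional.of_injective _ MultSpace.toLin_injective

/-- The inner product of `ℳ_l`: the normalised Hilbert–Schmidt product `tr(f† g) / dim 𝒬_l`. -/
def multInner (f g : MultSpace U l) : ℂ :=
  LinearMap.trace ℂ (IrrepSpace U l) (LinearMap.adjoint f.toLin ∘ₗ g.toLin) /
    (Module.finrank ℂ (IrrepSpace U l) : ℂ)

lemma multInner_eq_sum (f g : MultSpace U l) :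
    multInner f g = (∑ i, ⟪f.toLin (stdOrthonormalBasis ℂ (IrrepSpace U l) i),
      g.toLin (stdOrthonormalBasis ℂ (IrrepSpace U l) i)⟫_ℂ) /
      (Module.finrank ℂ (IrrepSpace U l) : ℂ) := by
  rw [multInner, LinearMap.trace_eq_sum_inner _ (stdOrthonormalBasis ℂ (IrrepSpace U l))]
  simp [LinearMap.adjoint_inner_right]

lemma multInner_self (f : MultSpace U l) :
    multInner f f = (((∑ i, ‖f.toLin (stdOrthonormalBasis ℂ (IrrepSpace U l) i)‖ ^ 2) /
      (Module.finrank ℂ (IrrepSpace U l) : ℝ) : ℝ) : ℂ) := by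
  rw [multInner_eq_sum]
  push_cast
  congr 1
  exact Finset.sum_congr rfl fun i _ => inner_self_eq_norm_sq_to_K _

lemma finrank_irrepSpace_ne_zero : (Module.finrank ℂ (IrrepSpace U l) : ℂ) ≠ 0 := by
  exact_mod_cast (Module.finrank_pos (R := ℂ) (M := IrrepSpace U l)).ne'

/-- `ℳ_l` is a Hilbert space. -/
@[reducible] def MultSpace.core : InnerProductSpace.Core ℂ (MultSpace U l) where
  inner := multInner
  conj_inner_symm f g := by
    simp [multInner_eq_sum]
  re_inner_nonneg f := by
    rw [multInner_self, RCLike.re_eq_complex_re, Complex.ofReal_re]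
    positivity
  add_left f g h := by
    simp [multInner_eq_sum, Finset.sum_add_distrib, add_div]
  smul_left f g r := by
    rw [multInner_eq_sum, multInner_eq_sum, ← mul_div_assoc, Finset.mul_sum]
    simp [mul_comm]
  definite f hf := by
    rw [multInner_self, Complex.ofReal_eq_zero, div_eq_zero_iff] at hf
    have h := hf.resolve_right (by exact_mod_cast finrank_irrepSpace_ne_zero (U := U) (l := l))
    rw [Finset.sum_eq_zero_iff_of_nonneg (fun _ _ => by positivity)] at h
    apply MultSpace.toLin_injective
    rw [map_zero]
    refine (stdOrthonormalBasis ℂ (IrrepSpace U l)).toBasis.ext fun i => ?_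
    simpa using h i (Finset.mem_univ i)

instance : NormedAddCommGroup (MultSpace U l) := (MultSpace.core (U := U)).toNormedAddCommGroup

instance : InnerProductSpace ℂ (MultSpace U l) := InnerProductSpace.ofCore MultSpace.core.toCore

lemma MultSpace.inner_def (f g : MultSpace U l) :
    ⟪f, g⟫_ℂ = LinearMap.trace ℂ (IrrepSpace U l) (LinearMap.adjoint f.toLin ∘ₗ g.toLin) /
      (Module.finrank ℂ (IrrepSpace U l) : ℂ) := rfl

lemma inner_multAct (V : invariantUnitaries U) (f g : MultSpace U l) :
    ⟪multAct V l f, multAct V l g⟫_ℂ = ⟪f, g⟫_ℂ := by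
  change multInner _ _ = multInner _ _
  simp only [multInner_eq_sum, multAct_toLin, LinearIsometryEquiv.inner_map_map]

/-- The homomorphism `π_l : 𝒱^G → U(ℳ_l)`, `π_l(V) f = V ∘ f`. Under `q ⊗ f ↦ f q` the unitary `V`
acts on the isotypic component of `l` as `𝟙 ⊗ π_l(V)`. -/
def multProj (U : G →* (H ≃ₗᵢ[ℂ] H)) (l : Irreps U) :
    invariantUnitaries U →* (MultSpace U l ≃ₗᵢ[ℂ] MultSpace U l) where
  toFun V := LinearEquiv.isometryOfInner
    (LinearEquiv.ofLinearMap (multAct V l) (multAct V⁻¹ l)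
      (LinearMap.ext fun f => MultSpace.toLin_injective <| LinearMap.ext fun q =>
        (V : H ≃ₗᵢ[ℂ] H).apply_symm_apply (f.toLin q))
      (LinearMap.ext fun f => MultSpace.toLin_injective <| LinearMap.ext fun q =>
        (V : H ≃ₗᵢ[ℂ] H).symm_apply_apply (f.toLin q)))
    (inner_multAct V)
  map_one' := LinearIsometryEquiv.ext fun _ => rfl
  map_mul' _ _ := LinearIsometryEquiv.ext fun _ => rfl

lemma multProj_toLin (V : invariantUnitaries U) (f : MultSpace U l) (q : IrrepSpace U l) :
    (multProj U l V f).toLin q = (V : H ≃ₗᵢ[ℂ] H) (f.toLin q) := rfl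

/-- The adjoint of `f ∈ ℳ_l` is an intertwining map `H → 𝒬_l`. -/
def MultSpace.adj (f : MultSpace U l) :
    Representation.IntertwiningMap (linRep U) (irrepSubrep U l).toRepresentation where
  toLinearMap := LinearMap.adjoint f.toLin
  isIntertwining' g := by
    ext x : 1
    apply ext_inner_right ℂ
    intro q
    have hq : q = (irrepSubrep U l).toRepresentation g
        ((irrepSubrep U l).toRepresentation g⁻¹ q) := by
      rw [← Module.End.mul_apply, ← map_mul, mul_inv_cancel, map_one, Module.End.one_apply]
    have hu (p r : IrrepSpace U l) : ⟪(irrepSubrep U l).toRepresentation g p,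
        (irrepSubrep U l).toRepresentation g r⟫_ℂ = ⟪p, r⟫_ℂ :=
      (U g).inner_map_map (p : H) (r : H)
    rw [hq]
    simp only [LinearMap.comp_apply]
    rw [hu, LinearMap.adjoint_inner_left, LinearMap.adjoint_inner_left, f.toLin_intertwines,
      linRep_apply, LinearIsometryEquiv.inner_map_map]

/-- The map `q ⊗ f ↦ f q` from `𝒬_l ⊗ ℳ_l` to `H` preserves inner products. -/
theorem inner_toLin_toLin (f f' : MultSpace U l) (q q' : IrrepSpace U l) :
    ⟪f.toLin q, f'.toLin q'⟫_ℂ = ⟪q, q'⟫_ℂ * ⟪f, f'⟫_ℂ := by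
  obtain ⟨c, hc⟩ := (Representation.IsIrreducible.algebraMap_intertwiningMap_bijective_of_isAlgClosed
    (ρ := (irrepSubrep U l).toRepresentation)).2 (f.adj.comp f')
  have h : LinearMap.adjoint f.toLin ∘ₗ f'.toLin = c • LinearMap.id :=
    (congrArg Representation.IntertwiningMap.toLinearMap hc).symm
  rw [MultSpace.inner_def, h, ← LinearMap.adjoint_inner_right, ← LinearMap.comp_apply, h]
  simp only [LinearMap.smul_apply, LinearMap.id_apply, inner_smul_right, map_smul,
    LinearMap.trace_id, smul_eq_mul]
  rw [mul_div_assoc, div_self finrank_irrepSpace_ne_zero, mul_one, mul_comm]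

/-- The isotypic components of distinct irreps are orthogonal. -/
theorem inner_toLin_eq_zero {l l' : Irreps U} (hl : l ≠ l') (f : MultSpace U l)
    (f' : MultSpace U l') (q : IrrepSpace U l) (q' : IrrepSpace U l') :
    ⟪f.toLin q, f'.toLin q'⟫_ℂ = 0 := by
  have : IsEmpty ((irrepSubrep U l').toRepresentation.Equiv (irrepSubrep U l).toRepresentation) :=
    ⟨fun e => hl (Quotient.out_equiv_out.1 ⟨e.symm⟩)⟩
  have h : f.adj.comp f' = 0 := Subsingleton.elim _ _
  have h2 : LinearMap.adjoint f.toLin ∘ₗ f'.toLin = 0 :=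
    congrArg Representation.IntertwiningMap.toLinearMap h
  rw [← LinearMap.adjoint_inner_right, ← LinearMap.comp_apply, h2]
  simp

/-- The isotypic components span `H`. -/
theorem span_toLin_eq_top :
    Submodule.span ℂ {x : H | ∃ (l : Irreps U) (f : MultSpace U l) (q : IrrepSpace U l),
      f.toLin q = x} = ⊤ := by
  set S := Submodule.span ℂ {x : H | ∃ (l : Irreps U) (f : MultSpace U l) (q : IrrepSpace U l),
      f.toLin q = x} with hS
  have hinv (g : G) (x : H) (hx : x ∈ S) : U g x ∈ S := by
    induction hx using Submodule.span_induction with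
    | mem x hx =>
      obtain ⟨l, f, q, rfl⟩ := hx
      rw [← f.toLin_intertwines]
      exact Submodule.subset_span ⟨l, f, _, rfl⟩
    | zero => simp
    | add x y _ _ hx hy => rw [map_add]; exact add_mem hx hy
    | smul c x _ hx => rw [map_smul]; exact Submodule.smul_mem _ _ hx
  let P : Subrepresentation (linRep U) := ⟨Sᗮ, fun g v hv => by
    rw [Submodule.mem_orthogonal] at hv ⊢
    intro u hu
    have h := hv _ (hinv g⁻¹ u hu)
    rw [map_inv] at h
    rw [← h, ← (U g).inner_map_map ((U g)⁻¹ u) v]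
    congr 1
    exact ((U g).apply_symm_apply u).symm⟩
  have hwf : WellFoundedLT (Subrepresentation (linRep U)) :=
    ⟨(InvImage.wf Subrepresentation.toSubmodule
      (wellFounded_lt (α := Submodule ℂ H)) : WellFounded fun a b : Subrepresentation (linRep U) =>
        a.toSubmodule < b.toSubmodule)⟩
  have hat : IsAtomic (Subrepresentation (linRep U)) :=
    isAtomic_of_orderBot_wellFounded_lt hwf.wf
  rw [← Submodule.orthogonal_eq_bot_iff]
  rcases hat.eq_bot_or_exists_atom_le P with h | ⟨X, hX, hXP⟩
  · exact congrArg Subrepresentation.toSubmodule h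
  · exfalso
    have hirr : X.toRepresentation.IsIrreducible := by
      refine { exists_pair_ne := ⟨⊥, ⊤, fun h => hX.1 ?_⟩, eq_bot_or_eq_top := fun Y => ?_ }
      · apply Subrepresentation.toSubmodule_injective
        have h1 : (⊥ : Submodule ℂ X.toSubmodule) = ⊤ := congrArg Subrepresentation.toSubmodule h
        exact (Submodule.subsingleton_iff_eq_bot).1
          ((Submodule.subsingleton_iff ℂ).1 (subsingleton_of_bot_eq_top h1))
      · let Z : Subrepresentation (linRep U) := ⟨Y.toSubmodule.map X.toSubmodule.subtype, by
          rintro g _ ⟨y, hy, rfl⟩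
          exact ⟨_, Y.apply_mem_toSubmodule g hy, rfl⟩⟩
        have hZ : Z ≤ X := by
          rintro _ ⟨y, _, rfl⟩
          exact y.2
        rcases hX.le_iff.1 hZ with h | h
        · left
          apply Subrepresentation.toSubmodule_injective
          have h1 : Y.toSubmodule.map X.toSubmodule.subtype = ⊥ :=
            congrArg Subrepresentation.toSubmodule h
          refine Submodule.map_injective_of_injective X.toSubmodule.injective_subtype ?_
          exact h1.trans (Submodule.map_bot _).symm
        · right
          apply Subrepresentation.toSubmodule_injective
          have h1 : Y.toSubmodule.map X.toSubmodule.subtype = X.toSubmodule :=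
            congrArg Subrepresentation.toSubmodule h
          refine Submodule.map_injective_of_injective X.toSubmodule.injective_subtype ?_
          change Y.toSubmodule.map X.toSubmodule.subtype =
            (⊤ : Submodule ℂ X.toSubmodule).map X.toSubmodule.subtype
          rw [h1, Submodule.map_subtype_top]
    let X' : IrredSubrep U := ⟨X, hirr⟩
    obtain ⟨e⟩ : Nonempty ((irrepSubrep U ⟦X'⟧).toRepresentation.Equiv X.toRepresentation) :=
      Quotient.mk_out X'
    let f : MultSpace U ⟦X'⟧ := ⟨X.toSubmodule.subtype ∘ₗ e.toLinearMap, fun g => by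
      ext q
      exact congrArg Subtype.val (e.toIntertwiningMap.isIntertwining _ _ g q)⟩
    refine hX.1 (Subrepresentation.toSubmodule_injective ((Submodule.eq_bot_iff _).2 fun x hx => ?_))
    have h1 : x ∈ S := Submodule.subset_span ⟨_, f, e.symm ⟨x, hx⟩,
      congrArg Subtype.val (e.apply_symm_apply ⟨x, hx⟩)⟩
    exact inner_self_eq_zero.1 ((Submodule.mem_orthogonal _ _).1 (hXP hx) x h1)

end Setup

/-- The group `SU(E)` of unitaries of determinant one on `E`. -/
def specialUnitary (E : Type*) [NormedAddCommGroup E] [InnerProductSpace ℂ E] :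
    Subgroup (E ≃ₗᵢ[ℂ] E) where
  carrier := {v | LinearMap.det v.toLinearEquiv.toLinearMap = 1}
  one_mem' := LinearMap.det_id
  mul_mem' {v w} hv hw := by
    have h : LinearMap.det (v.toLinearEquiv.toLinearMap ∘ₗ w.toLinearEquiv.toLinearMap) = 1 := by
      rw [LinearMap.det_comp, hv, hw, one_mul]
    exact h
  inv_mem' {v} hv := by
    have h : LinearMap.det (v.toLinearEquiv.symm.toLinearMap ∘ₗ v.toLinearEquiv.toLinearMap) = 1 := by
      rw [LinearEquiv.symm_comp, LinearMap.det_id]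
    rw [LinearMap.det_comp, hv, mul_one] at h
    exact h

/-- The trace of a unitary. -/
def unitaryTrace {E : Type*} [NormedAddCommGroup E] [InnerProductSpace ℂ E]
    (v : E ≃ₗᵢ[ℂ] E) : ℂ :=
  LinearMap.trace ℂ E v.toLinearEquiv.toLinearMap

end SymmetricUnitaries

end

/-! Condition A makes each projection of `T` large, so only correlations between components can keep
`T` from containing the special unitary group of each multiplicity space separately. For two
components with multiplicity spaces E and F, let a and b be the actions of `T` on them. The image
under a of the kernel of b is normalised by SU(E), and a subgroup normalised by SU(E) with a
non-scalar element contains SU(E) (`specialUnitary_le_of_not_mem_phase_range`). If that image is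
scalar, then dim F ≥ 2 and a t, b t are scalar for the same t, so one quotient of `T` is both PU(E)
and PU(F). Rigidity (`norm_unitaryTrace_eq_of_same_kernel`) then gives dim E = dim F and |Tr a t| =
|Tr b t| for all t, which B forbids (`specialUnitary_le_map_ker`).

As `T` need not be closed, this isomorphism PU(E) ≅ PU(F) is abstract, and continuity has to be
derived. Complex reflections of prime order p > dim are recognised by counting commuting conjugates:
a reflection has at most dim E of them modulo scalars, any other non-scalar element of order p
modulo scalars has more. So reflections go to reflections, which yields an orthogonality-preserving
map of lines and an injective endomorphism σ of the circle acting on angles. Comparing traces of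
products of two reflections shows that σ is continuous, hence the identity or inversion; spectra are
then preserved or conjugated up to a scalar, and |Tr| is unchanged.

Since the special unitary group is perfect, pairwise independence upgrades to joint independence by
taking commutators (`specialUnitary_le_map_kernelOn`), and a commutator of invariant unitaries is
assembled in `T` one component at a time. Conversely, commutators of unitaries supported on one
component already give its special unitary group, whence A and B. -/

noncomputable section

namespace SymmetricUnitaries

open scoped commutatorElement

set_option linter.unusedSectionVars false
set_option linter.unusedSimpArgs false

/-! ### Complex reflections, determinants and diagonalisation of unitaries -/

section Rotations

variable {E : Type*} [NormedAddCommGroup E] [InnerProductSpace ℂ E] [FiniteDimensional ℂ E]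

/-- The linear map acting as `z` on `S` and as the identity on the orthogonal complement of `S`. -/
def twistLin (S : Submodule ℂ E) (z : Circle) : E →ₗ[ℂ] E :=
  LinearMap.id + ((z : ℂ) - 1) • S.starProjection.toLinearMap

lemma twistLin_apply (S : Submodule ℂ E) (z : Circle) (x : E) :
    twistLin S z x = x + ((z : ℂ) - 1) • S.starProjection x := rfl

lemma starProjection_idem (S : Submodule ℂ E) (x : E) :
    S.starProjection (S.starProjection x) = S.starProjection x :=
  Submodule.starProjection_eq_self_iff.2 (Submodule.starProjection_apply_mem S x)

lemma twistLin_mul (S : Submodule ℂ E) (z w : Circle) (x : E) :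
    twistLin S z (twistLin S w x) = twistLin S (z * w) x := by
  simp only [twistLin_apply, map_add, map_smul, starProjection_idem, Circle.coe_mul]
  module

lemma twistLin_one (S : Submodule ℂ E) (x : E) : twistLin S 1 x = x := by
  simp [twistLin_apply]

lemma coe_prod_circle {ι : Type*} (s : Finset ι) (μ : ι → Circle) :
    ((∏ i ∈ s, μ i : Circle) : ℂ) = ∏ i ∈ s, (μ i : ℂ) :=
  map_prod Circle.coeHom μ s

lemma circle_conj_mul_self (z : Circle) : (starRingEnd ℂ) (z : ℂ) * z = 1 := by
  rw [mul_comm, Complex.mul_conj, Circle.normSq_coe, Complex.ofReal_one]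

lemma inner_twistLin (S : Submodule ℂ E) (z : Circle) (x y : E) :
    ⟪twistLin S z x, twistLin S z y⟫_ℂ = ⟪x, y⟫_ℂ := by
  have h1 : ⟪S.starProjection x, S.starProjection y⟫_ℂ = ⟪x, S.starProjection y⟫_ℂ := by
    rw [Submodule.inner_starProjection_left_eq_right, starProjection_idem]
  simp only [twistLin_apply, inner_add_left, inner_add_right, inner_smul_left, inner_smul_right, h1,
    Submodule.inner_starProjection_left_eq_right]
  simp only [map_sub, map_one]
  linear_combination (⟪x, S.starProjection y⟫_ℂ) * circle_conj_mul_self z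

/-- The unitaries acting as a scalar of modulus one on `S` and as the identity on the orthogonal
complement of `S`. -/
def twist (S : Submodule ℂ E) : Circle →* (E ≃ₗᵢ[ℂ] E) where
  toFun z := LinearEquiv.isometryOfInner
    (LinearEquiv.ofLinearMap (twistLin S z) (twistLin S z⁻¹)
      (LinearMap.ext fun x => by simp [twistLin_mul, twistLin_one])
      (LinearMap.ext fun x => by simp [twistLin_mul, twistLin_one]))
    (inner_twistLin S z)
  map_one' := LinearIsometryEquiv.ext fun x => twistLin_one S x
  map_mul' z w := LinearIsometryEquiv.ext fun x => (twistLin_mul S z w x).symm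

lemma twist_apply (S : Submodule ℂ E) (z : Circle) (x : E) :
    twist S z x = x + ((z : ℂ) - 1) • S.starProjection x := rfl

/-- Multiplication by a scalar of modulus one. -/
def phase (E : Type*) [NormedAddCommGroup E] [InnerProductSpace ℂ E] [FiniteDimensional ℂ E] :
    Circle →* (E ≃ₗᵢ[ℂ] E) := twist ⊤

@[simp] lemma phase_apply (z : Circle) (x : E) : phase E z x = (z : ℂ) • x := by
  rw [phase, twist_apply, Submodule.starProjection_top]
  simp [sub_smul]

lemma phase_comm (z : Circle) (v : E ≃ₗᵢ[ℂ] E) : phase E z * v = v * phase E z :=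
  LinearIsometryEquiv.ext fun x => by simp

/-- The complex reflections: `rot u z` multiplies `u` by `z` and fixes the orthogonal complement
of `u`. -/
def rot (u : E) : Circle →* (E ≃ₗᵢ[ℂ] E) := twist (Submodule.span ℂ {u})

lemma rot_apply {u : E} (hu : ‖u‖ = 1) (z : Circle) (x : E) :
    rot u z x = x + (((z : ℂ) - 1) * ⟪u, x⟫_ℂ) • u := by
  rw [rot, twist_apply, Submodule.starProjection_unit_singleton ℂ hu, smul_smul]

lemma rot_apply_self {u : E} (hu : ‖u‖ = 1) (z : Circle) : rot u z u = (z : ℂ) • u := by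
  rw [rot_apply hu, inner_self_eq_norm_sq_to_K, hu]
  simp [sub_smul]

lemma rot_apply_of_inner_eq_zero {u x : E} (hu : ‖u‖ = 1) (h : ⟪u, x⟫_ℂ = 0) (z : Circle) :
    rot u z x = x := by
  rw [rot_apply hu, h]
  simp

lemma conj_rot (v : E ≃ₗᵢ[ℂ] E) {u : E} (hu : ‖u‖ = 1) (z : Circle) :
    v * rot u z * v⁻¹ = rot (v u) z := by
  rw [mul_inv_eq_iff_eq_mul]
  ext x
  have hv : ‖v u‖ = 1 := by rw [v.norm_map, hu]
  simp [rot_apply hu, rot_apply hv]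

lemma mul_rot (v : E ≃ₗᵢ[ℂ] E) {u : E} (hu : ‖u‖ = 1) (z : Circle) :
    v * rot u z = rot (v u) z * v := by
  rw [← conj_rot v hu]; simp

/-- The reflection depends only on the line, so phases picked up when lifting a unitary to `T` do no
harm. -/
lemma rot_smul {u : E} {c : ℂ} (hc : c ≠ 0) : rot (c • u) = rot u := by
  rw [rot, rot, Submodule.span_singleton_smul_eq (IsUnit.mk0 c hc)]

/-- The determinant as a homomorphism on unitaries. -/
def unitaryDet : (E ≃ₗᵢ[ℂ] E) →* ℂ where
  toFun v := LinearMap.det v.toLinearEquiv.toLinearMap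
  map_one' := LinearMap.det_id
  map_mul' v w := by
    change LinearMap.det (v.toLinearEquiv.toLinearMap ∘ₗ w.toLinearEquiv.toLinearMap) = _
    rw [LinearMap.det_comp]

lemma mem_specialUnitary {v : E ≃ₗᵢ[ℂ] E} : v ∈ specialUnitary E ↔ unitaryDet v = 1 := Iff.rfl

lemma unitaryDet_phase (z : Circle) : unitaryDet (phase E z) = (z : ℂ) ^ Module.finrank ℂ E := by
  have h : (phase E z).toLinearEquiv.toLinearMap = (z : ℂ) • LinearMap.id :=
    LinearMap.ext fun x => phase_apply z x
  change LinearMap.det (phase E z).toLinearEquiv.toLinearMap = _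
  rw [h, LinearMap.det_smul, LinearMap.det_id, mul_one]

lemma unitaryDet_conj (v w : E ≃ₗᵢ[ℂ] E) : unitaryDet (v * w * v⁻¹) = unitaryDet w := by
  rw [map_mul, map_mul, mul_right_comm, ← map_mul, mul_inv_cancel, map_one, one_mul]

lemma commutator_mem_specialUnitary (v w : E ≃ₗᵢ[ℂ] E) : ⁅v, w⁆ ∈ specialUnitary E := by
  rw [mem_specialUnitary, commutatorElement_def, map_mul, unitaryDet_conj, ← map_mul,
    mul_inv_cancel, map_one]

section Diagonal

variable {ι : Type*} [Fintype ι]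

/-- The linear map that is diagonal in the orthonormal basis `b`. -/
def diagLin (b : OrthonormalBasis ι ℂ E) (μ : ι → Circle) : E →ₗ[ℂ] E :=
  b.toBasis.constr ℂ fun i => (μ i : ℂ) • b i

@[simp] lemma diagLin_apply_basis (b : OrthonormalBasis ι ℂ E) (μ : ι → Circle) (i : ι) :
    diagLin b μ (b i) = (μ i : ℂ) • b i := by
  have := b.toBasis.constr_basis ℂ (fun i => (μ i : ℂ) • b i) i
  rwa [b.coe_toBasis] at this

lemma diagLin_comp (b : OrthonormalBasis ι ℂ E) (μ ν : ι → Circle) :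
    diagLin b μ ∘ₗ diagLin b ν = diagLin b (μ * ν) := by
  apply b.toBasis.ext
  intro i
  simp [smul_smul, mul_comm]

lemma diagLin_one (b : OrthonormalBasis ι ℂ E) : diagLin b 1 = LinearMap.id := by
  apply b.toBasis.ext
  intro i
  simp

/-- The unitaries that are diagonal in the orthonormal basis `b`. -/
def diagHom (b : OrthonormalBasis ι ℂ E) : (ι → Circle) →* (E ≃ₗᵢ[ℂ] E) where
  toFun μ := LinearEquiv.isometryOfOrthonormal
    (LinearEquiv.ofLinearMap (diagLin b μ) (diagLin b μ⁻¹)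
      (by rw [diagLin_comp, mul_inv_cancel, diagLin_one])
      (by rw [diagLin_comp, inv_mul_cancel, diagLin_one])) (v := b.toBasis)
    (by rw [b.coe_toBasis]; exact b.orthonormal) (by
      classical
      rw [orthonormal_iff_ite]
      intro i j
      have h := orthonormal_iff_ite.1 b.orthonormal i j
      simp only [Function.comp, b.coe_toBasis]
      change ⟪diagLin b μ (b i), diagLin b μ (b j)⟫_ℂ = _
      simp only [diagLin_apply_basis, inner_smul_left, inner_smul_right, h]
      split_ifs with hij
      · subst hij
        rw [mul_one, mul_comm]; exact circle_conj_mul_self _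
      · simp)
  map_one' := LinearIsometryEquiv.ext fun x => DFunLike.congr_fun (diagLin_one b) x
  map_mul' μ ν := LinearIsometryEquiv.ext fun x => (DFunLike.congr_fun (diagLin_comp b μ ν) x).symm

@[simp] lemma diagHom_apply_basis (b : OrthonormalBasis ι ℂ E) (μ : ι → Circle) (i : ι) :
    diagHom b μ (b i) = (μ i : ℂ) • b i :=
  diagLin_apply_basis b μ i

lemma ext_basis (b : OrthonormalBasis ι ℂ E) {v w : E ≃ₗᵢ[ℂ] E} (h : ∀ i, v (b i) = w (b i)) :
    v = w := by
  apply LinearIsometryEquiv.toLinearEquiv_injective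
  apply LinearEquiv.toLinearMap_injective
  apply b.toBasis.ext
  simpa using h

lemma diagHom_mulSingle [DecidableEq ι] (b : OrthonormalBasis ι ℂ E) (i : ι) (z : Circle) :
    diagHom b (Pi.mulSingle i z) = rot (b i) z := by
  apply ext_basis b
  intro j
  rw [diagHom_apply_basis]
  rcases eq_or_ne i j with rfl | h
  · rw [rot_apply_self (b.norm_eq_one i), Pi.mulSingle_eq_same]
  · rw [rot_apply_of_inner_eq_zero (b.norm_eq_one i) (b.orthonormal.2 h),
      Pi.mulSingle_eq_of_ne h.symm]
    simp

lemma unitaryDet_diagHom (b : OrthonormalBasis ι ℂ E) (μ : ι → Circle) :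
    unitaryDet (diagHom b μ) = ∏ i, (μ i : ℂ) := by
  classical
  change LinearMap.det (diagLin b μ) = _
  have h : LinearMap.toMatrix b.toBasis b.toBasis (diagLin b μ)
      = Matrix.diagonal fun i => (μ i : ℂ) := by
    ext i j
    rw [LinearMap.toMatrix_apply, b.coe_toBasis, diagLin_apply_basis, map_smul]
    simp only [OrthonormalBasis.coe_toBasis_repr, OrthonormalBasis.coe_toBasis_repr_apply,
      Finsupp.smul_apply, b.repr_self, Matrix.diagonal_apply]
    rcases eq_or_ne i j with rfl | hij
    · simp
    · simp [hij]
  rw [← LinearMap.det_toMatrix b.toBasis, h, Matrix.det_diagonal]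

lemma unitaryTrace_eq_sum_inner (v : E ≃ₗᵢ[ℂ] E) (b : OrthonormalBasis ι ℂ E) :
    unitaryTrace v = ∑ i, ⟪b i, v (b i)⟫_ℂ :=
  LinearMap.trace_eq_sum_inner _ b

lemma unitaryTrace_diagHom (b : OrthonormalBasis ι ℂ E) (μ : ι → Circle) :
    unitaryTrace (diagHom b μ) = ∑ i, (μ i : ℂ) := by
  rw [unitaryTrace_eq_sum_inner _ b]
  simp [inner_smul_right]

end Diagonal

/-- Unitaries are diagonalisable in an orthonormal basis. -/
theorem exists_eq_diagHom (v : E ≃ₗᵢ[ℂ] E) :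
    ∃ (b : OrthonormalBasis (Fin (Module.finrank ℂ E)) ℂ E)
      (μ : Fin (Module.finrank ℂ E) → Circle), v = diagHom b μ := by
  classical
  set f : Module.End ℂ E := v.toLinearEquiv.toLinearMap with hf
  have hfa (x : E) : f x = v x := rfl
  -- If the inner product is nonzero, isometry forces conj c · d = 1, while |c| = 1 gives conj c · c
  -- = 1.
  have hinner {c d : ℂ} (hcd : c ≠ d) {x y : E} (hx : f x = c • x) (hy : f y = d • y) :
      ⟪x, y⟫_ℂ = 0 := by
    by_contra hne
    have hx0 : x ≠ 0 := by rintro rfl; simp at hne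
    have hc : ‖c‖ = 1 := by
      have h := congrArg norm hx
      rw [hfa, v.norm_map, norm_smul] at h
      exact (mul_eq_right₀ (norm_ne_zero_iff.2 hx0)).1 h.symm
    have h := v.inner_map_map x y
    rw [← hfa, ← hfa, hx, hy, inner_smul_left, inner_smul_right, ← mul_assoc] at h
    have h2 := (mul_eq_right₀ hne).1 h
    have h3 : (starRingEnd ℂ) c * c = 1 := by
      rw [mul_comm, Complex.mul_conj, Complex.normSq_eq_norm_sq, hc]; simp
    have hc0 : (starRingEnd ℂ) c ≠ 0 := left_ne_zero_of_mul_eq_one h3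
    exact hcd (mul_left_cancel₀ hc0 (h3.trans h2.symm))
  let V : f.Eigenvalues → Submodule ℂ E := fun c => f.eigenspace c
  have hfam : OrthogonalFamily ℂ (fun c => V c) fun c => (V c).subtypeₗᵢ := by
    apply OrthogonalFamily.of_pairwise
    intro c d hcd
    refine Submodule.isOrtho_iff_inner_eq.2 fun x hx y hy => ?_
    exact hinner (fun h => hcd (Subtype.ext h)) (Module.End.mem_eigenspace_iff.1 hx)
      (Module.End.mem_eigenspace_iff.1 hy)
  have hint : DirectSum.IsInternal V := by
    rw [hfam.isInternal_iff]
    set W := (iSup V)ᗮ with hW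
    -- The complement of all eigenspaces is invariant; were it nonzero, it would contain an
    -- eigenvector, orthogonal to itself.
    have hmaps : ∀ x ∈ W, f x ∈ W := by
      intro x hx
      rw [hW, Submodule.mem_orthogonal] at hx ⊢
      intro y hy
      induction hy using Submodule.iSup_induction' with
      | mem c y hy =>
        have h1 := hx y (Submodule.mem_iSup_of_mem c hy)
        have h2 : f y = (c : ℂ) • y := Module.End.mem_eigenspace_iff.1 hy
        have h3 : ⟪f y, f x⟫_ℂ = 0 := by rw [hfa, hfa, v.inner_map_map, h1]
        rw [h2, inner_smul_left] at h3
        rcases mul_eq_zero.1 h3 with h | h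
        · have h4 : v y = 0 := by rw [← hfa, h2, (map_eq_zero _).1 h, zero_smul]
          rw [(map_eq_zero_iff v v.injective).1 h4, inner_zero_left]
        · exact h
      | zero => simp
      | add y z _ _ hy hz => rw [inner_add_left, hy, hz, add_zero]
    by_contra hne
    have : Nontrivial W := Submodule.nontrivial_iff_ne_bot.2 hne
    obtain ⟨c, hc⟩ := Module.End.exists_eigenvalue (f.restrict hmaps)
    obtain ⟨x, hx⟩ := hc.exists_hasEigenvector
    have hx1 : f (x : E) = c • (x : E) := congrArg Subtype.val hx.apply_eq_smul
    have hx2 : (x : E) ≠ 0 := fun h => hx.2 (Subtype.ext h)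
    have hcv : f.HasEigenvalue c :=
      Module.End.hasEigenvalue_of_hasEigenvector ⟨Module.End.mem_eigenspace_iff.2 hx1, hx2⟩
    have hm : (x : E) ∈ iSup V :=
      Submodule.mem_iSup_of_mem (⟨c, hcv⟩ : f.Eigenvalues) (Module.End.mem_eigenspace_iff.2 hx1)
    exact hx2 (inner_self_eq_zero.1 (Submodule.inner_right_of_mem_orthogonal hm x.2))
  let b := hint.subordinateOrthonormalBasis rfl hfam
  have hb (i) : ∃ c : Circle, v (b i) = (c : ℂ) • b i := by
    have h : f (b i) = _ • b i :=
      Module.End.mem_eigenspace_iff.1 (hint.subordinateOrthonormalBasis_subordinate rfl i hfam)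
    refine ⟨⟨_, mem_sphere_zero_iff_norm.2 ?_⟩, h⟩
    have h' := congrArg norm h
    rw [hfa, v.norm_map, norm_smul, b.norm_eq_one, mul_one] at h'
    exact h'.symm
  choose μ hμ using hb
  exact ⟨b, μ, ext_basis b fun i => by rw [hμ, diagHom_apply_basis]⟩

lemma norm_unitaryTrace_phase_mul (c : Circle) (v : E ≃ₗᵢ[ℂ] E) :
    ‖unitaryTrace (phase E c * v)‖ = ‖unitaryTrace v‖ := by
  rw [unitaryTrace_eq_sum_inner _ (stdOrthonormalBasis ℂ E),
    unitaryTrace_eq_sum_inner _ (stdOrthonormalBasis ℂ E)]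
  simp [inner_smul_right, ← Finset.mul_sum, Circle.norm_coe]

/-- Divide by a root of the determinant of order dim E. Scalars being central, conjugation and
commutators with arbitrary unitaries thereby reduce to determinant one. -/
lemma exists_phase_mul_mem_specialUnitary [Nontrivial E] (v : E ≃ₗᵢ[ℂ] E) :
    ∃ c : Circle, phase E c * v ∈ specialUnitary E := by
  obtain ⟨b, μ, rfl⟩ := exists_eq_diagHom v
  have hn : Module.finrank ℂ E ≠ 0 := Module.finrank_pos.ne'
  obtain ⟨d, hd⟩ : ∃ d : Circle, d ^ Module.finrank ℂ E = (∏ i, μ i)⁻¹ := by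
    obtain ⟨t, ht⟩ := Circle.exp_surjective (∏ i, μ i)⁻¹
    refine ⟨Circle.exp (t / Module.finrank ℂ E), ?_⟩
    rw [← Circle.exp_nsmul, ← ht]
    congr 1
    rw [nsmul_eq_mul]; field_simp
  refine ⟨d, ?_⟩
  rw [mem_specialUnitary, map_mul, unitaryDet_phase, unitaryDet_diagHom]
  have := congrArg (fun z : Circle => (z : ℂ)) hd
  simp only [Circle.coe_pow, Circle.coe_inv, coe_prod_circle] at this
  rw [this, inv_mul_cancel₀]
  exact Finset.prod_ne_zero_iff.2 fun i _ => Circle.coe_ne_zero _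

end Rotations

/-! ### Generators and perfectness of SU(E); products of two reflections -/

section Generation

variable {E : Type*} [NormedAddCommGroup E] [InnerProductSpace ℂ E] [FiniteDimensional ℂ E]

lemma exists_orthonormalBasis_extending {k : ℕ} {f : Fin k → E} (hf : Orthonormal ℂ f) :
    ∃ (b : OrthonormalBasis (Fin (Module.finrank ℂ E)) ℂ E)
      (e : Fin k ↪ Fin (Module.finrank ℂ E)), ∀ i, b (e i) = f i := by
  have hk : k ≤ Module.finrank ℂ E := by
    simpa using hf.linearIndependent.fintype_card_le_finrank
  let v : Fin (Module.finrank ℂ E) → E := fun i => if h : (i : ℕ) < k then f ⟨i, h⟩ else 0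
  let s : Set (Fin (Module.finrank ℂ E)) := {i | (i : ℕ) < k}
  have hv : Orthonormal ℂ (s.domRestrict v) := by
    have : s.domRestrict v = f ∘ fun i : s => (⟨i.1, i.2⟩ : Fin k) := by
      ext i
      have hi : ((i : Fin (Module.finrank ℂ E)) : ℕ) < k := i.2
      simp [v, hi]
    rw [this]
    refine hf.comp _ fun i j hij => ?_
    have := congrArg Fin.val hij
    exact Subtype.ext (Fin.ext this)
  obtain ⟨b, hb⟩ := hv.exists_orthonormalBasis_extension_of_card_eq (by simp)
  refine ⟨b, Fin.castLEEmb hk, fun i => ?_⟩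
  rw [hb _ (show ((Fin.castLEEmb hk i : Fin _) : ℕ) < k from i.2)]
  simp [v]

lemma exists_map_orthonormal {k : ℕ} {f g : Fin k → E} (hf : Orthonormal ℂ f)
    (hg : Orthonormal ℂ g) : ∃ v : E ≃ₗᵢ[ℂ] E, ∀ i, v (f i) = g i := by
  obtain ⟨b, e, hb⟩ := exists_orthonormalBasis_extending hf
  obtain ⟨b', e', hb'⟩ := exists_orthonormalBasis_extending hg
  obtain ⟨σ, hσ⟩ : ∃ σ : Equiv.Perm (Fin (Module.finrank ℂ E)), ∀ i, σ (e i) = e' i := by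
    classical
    obtain ⟨σ, hσ⟩ := Equiv.Perm.exists_extending_pair e e' e.injective e'.injective
    exact ⟨σ, hσ⟩
  refine ⟨b.equiv b' σ, fun i => ?_⟩
  rw [← hb, OrthonormalBasis.equiv_apply_basis, hσ, hb']

lemma isometryEquiv_mul_apply (v w : E ≃ₗᵢ[ℂ] E) (x : E) : (v * w) x = v (w x) := rfl

lemma orthonormal_vec_two {u w : E} (hu : ‖u‖ = 1) (hw : ‖w‖ = 1) (h : ⟪u, w⟫_ℂ = 0) :
    Orthonormal ℂ ![u, w] := by
  have h' : ⟪w, u⟫_ℂ = 0 := inner_eq_zero_symm.1 h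
  refine ⟨fun i => ?_, fun i j hij => ?_⟩
  · fin_cases i <;> simp [hu, hw]
  · fin_cases i <;> fin_cases j <;> simp_all

lemma orthonormal_vec_one {u : E} (hu : ‖u‖ = 1) : Orthonormal ℂ ![u] := by
  refine ⟨fun i => ?_, fun i j hij => (hij (Subsingleton.elim _ _)).elim⟩
  fin_cases i; simp [hu]

lemma exists_map_pair {u w u' w' : E} (hu : ‖u‖ = 1) (hw : ‖w‖ = 1) (h : ⟪u, w⟫_ℂ = 0)
    (hu' : ‖u'‖ = 1) (hw' : ‖w'‖ = 1) (h' : ⟪u', w'⟫_ℂ = 0) :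
    ∃ v : E ≃ₗᵢ[ℂ] E, v u = u' ∧ v w = w' := by
  obtain ⟨v, hv⟩ := exists_map_orthonormal (orthonormal_vec_two hu hw h)
    (orthonormal_vec_two hu' hw' h')
  exact ⟨v, hv 0, hv 1⟩

lemma exists_map_unit {u u' : E} (hu : ‖u‖ = 1) (hu' : ‖u'‖ = 1) :
    ∃ v : E ≃ₗᵢ[ℂ] E, v u = u' := by
  obtain ⟨v, hv⟩ := exists_map_orthonormal (orthonormal_vec_one hu) (orthonormal_vec_one hu')
  exact ⟨v, hv 0⟩

lemma exists_basis_apply_eq {u : E} (hu : ‖u‖ = 1) :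
    ∃ (b : OrthonormalBasis (Fin (Module.finrank ℂ E)) ℂ E) (i : Fin (Module.finrank ℂ E)),
      b i = u := by
  obtain ⟨b, e, hb⟩ := exists_orthonormalBasis_extending (orthonormal_vec_one hu)
  exact ⟨b, e 0, hb 0⟩

lemma exists_unit_inner_eq_zero (hn : 2 ≤ Module.finrank ℂ E) {u : E} (hu : ‖u‖ = 1) :
    ∃ w : E, ‖w‖ = 1 ∧ ⟪u, w⟫_ℂ = 0 := by
  obtain ⟨b, i, rfl⟩ := exists_basis_apply_eq hu
  have : Nontrivial (Fin (Module.finrank ℂ E)) := Fin.nontrivial_iff_two_le.2 hn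
  obtain ⟨j, hj⟩ := exists_ne i
  exact ⟨b j, b.norm_eq_one j, b.orthonormal.2 hj.symm⟩

lemma exists_norm_eq_one_of_two_le (hn : 2 ≤ Module.finrank ℂ E) : ∃ u : E, ‖u‖ = 1 :=
  ⟨stdOrthonormalBasis ℂ E ⟨0, by omega⟩, OrthonormalBasis.norm_eq_one _ _⟩

/-- The unitary of determinant one acting as `z` on `u` and as `z⁻¹` on `w`. -/
def rotPair (u w : E) (z : Circle) : E ≃ₗᵢ[ℂ] E := rot u z * rot w z⁻¹

lemma rot_commute {u w : E} (hu : ‖u‖ = 1) (hw : ‖w‖ = 1) (h : ⟪u, w⟫_ℂ = 0) (z y : Circle) :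
    Commute (rot u z) (rot w y) := by
  rw [Commute, SemiconjBy, mul_rot _ hw, rot_apply_of_inner_eq_zero hu h]

lemma conj_rotPair (v : E ≃ₗᵢ[ℂ] E) {u w : E} (hu : ‖u‖ = 1) (hw : ‖w‖ = 1) (z : Circle) :
    v * rotPair u w z * v⁻¹ = rotPair (v u) (v w) z := by
  rw [rotPair, rotPair, ← conj_rot v hu, ← conj_rot v hw]; group

lemma rotPair_inv (u w : E) (z : Circle) :
    (rotPair u w z)⁻¹ = rotPair w u z := by
  rw [rotPair, rotPair, mul_inv_rev, ← map_inv, ← map_inv, inv_inv]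

lemma rotPair_inv_right {u w : E} (hu : ‖u‖ = 1) (hw : ‖w‖ = 1) (h : ⟪u, w⟫_ℂ = 0) (z : Circle) :
    rotPair u w z⁻¹ = rotPair w u z := by
  rw [rotPair, rotPair, inv_inv, (rot_commute hu hw h _ _).eq]

lemma rotPair_pow {u w : E} (hu : ‖u‖ = 1) (hw : ‖w‖ = 1) (h : ⟪u, w⟫_ℂ = 0) (z : Circle) (k : ℕ) :
    rotPair u w z ^ k = rotPair u w (z ^ k) := by
  rw [rotPair, rotPair, (rot_commute hu hw h _ _).mul_pow, ← map_pow, ← map_pow, inv_pow]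

/-- All reflections of angle `z` are conjugate, so the two determinants cancel, whatever the angle
between the lines of `u` and `w`. -/
lemma rotPair_mem_specialUnitary {u w : E} (hu : ‖u‖ = 1) (hw : ‖w‖ = 1) (z : Circle) :
    rotPair u w z ∈ specialUnitary E := by
  obtain ⟨g, rfl⟩ := exists_map_unit hu hw
  rw [mem_specialUnitary, rotPair, ← conj_rot g hu, map_mul, unitaryDet_conj, ← map_mul, ← map_mul,
    mul_inv_cancel, map_one, map_one]

/-- The special unitary group is generated by the `rotPair`s. -/
theorem specialUnitary_le_of_rotPair_mem (N : Subgroup (E ≃ₗᵢ[ℂ] E))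
    (hN : ∀ u w : E, ‖u‖ = 1 → ‖w‖ = 1 → ⟪u, w⟫_ℂ = 0 → ∀ z, rotPair u w z ∈ N) :
    specialUnitary E ≤ N := by
  intro s hs
  obtain ⟨b, μ, rfl⟩ := exists_eq_diagHom s
  rw [mem_specialUnitary, unitaryDet_diagHom, ← coe_prod_circle, Circle.coe_eq_one] at hs
  rcases isEmpty_or_nonempty (Fin (Module.finrank ℂ E)) with h | ⟨⟨i₀⟩⟩
  · rw [Subsingleton.elim μ 1, map_one]
    exact one_mem _
  -- The entries multiply to 1, so inserting every inverse at the single index `i₀` changes nothing.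
  · have hμ : μ = ∏ i, (Pi.mulSingle i (μ i) * Pi.mulSingle i₀ (μ i)⁻¹) := by
      rw [Finset.prod_mul_distrib, Finset.univ_prod_mulSingle]
      have h1 : ∏ i, (Pi.mulSingle i₀ (μ i)⁻¹ : Fin (Module.finrank ℂ E) → Circle) =
          Pi.mulSingle i₀ (∏ i, (μ i)⁻¹) :=
        (map_prod (MonoidHom.mulSingle (fun _ : Fin (Module.finrank ℂ E) => Circle) i₀) _ _).symm
      rw [h1, Finset.prod_inv_distrib, hs, inv_one, Pi.mulSingle_one, mul_one]
    suffices h : μ ∈ N.comap (diagHom b) from h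
    rw [hμ]
    refine Subgroup.prod_mem _ fun i _ => ?_
    rw [Subgroup.mem_comap, map_mul, diagHom_mulSingle, diagHom_mulSingle]
    rcases eq_or_ne i i₀ with rfl | hi
    · rw [← map_mul, mul_inv_cancel, map_one]
      exact one_mem _
    · exact hN _ _ (b.norm_eq_one i) (b.norm_eq_one i₀) (b.orthonormal.2 hi) _

lemma exists_circle_pow_eq (z : Circle) {k : ℕ} (hk : k ≠ 0) : ∃ y : Circle, y ^ k = z := by
  obtain ⟨t, rfl⟩ := Circle.exp_surjective z
  refine ⟨Circle.exp (t / k), ?_⟩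
  rw [← Circle.exp_nsmul]
  congr 1
  rw [nsmul_eq_mul]; field_simp

lemma conj_phase_mul (c : Circle) (v w : E ≃ₗᵢ[ℂ] E) :
    (phase E c * v) * w * (phase E c * v)⁻¹ = v * w * v⁻¹ := by
  have h : (phase E c * v) * w * (phase E c * v)⁻¹ =
      phase E c * (v * w * v⁻¹) * (phase E c)⁻¹ := by group
  rw [h, phase_comm, mul_inv_cancel_right]

/-- The special unitary group is perfect. -/
theorem specialUnitary_le_commutator :
    specialUnitary E ≤ ⁅specialUnitary E, specialUnitary E⁆ := by
  refine specialUnitary_le_of_rotPair_mem _ fun u w hu hw h z => ?_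
  obtain ⟨y, rfl⟩ := exists_circle_pow_eq z two_ne_zero
  -- Swapping `u` and `w` inverts `rotPair u w y`, so its commutator with `g` is its square; hence
  -- the square root `y`.
  obtain ⟨g, hgu, hgw⟩ := exists_map_pair hu hw h hw hu (inner_eq_zero_symm.1 h)
  have : Nontrivial E := ⟨u, 0, fun h => by simp [h] at hu⟩
  obtain ⟨c, hc⟩ := exists_phase_mul_mem_specialUnitary g
  have := Subgroup.commutator_mem_commutator (rotPair_mem_specialUnitary hu hw y) hc
  have h2 : ⁅rotPair u w y, phase E c * g⁆ = rotPair u w (y ^ 2) := by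
    rw [commutatorElement_def, mul_assoc (rotPair u w y), mul_assoc (rotPair u w y),
      rotPair_inv, conj_phase_mul, conj_rotPair _ hw hu, hgu, hgw, ← sq,
      rotPair_pow hu hw h]
  rwa [h2] at this

/-- The trace of a product of two complex reflections. -/
lemma unitaryTrace_rot_mul_rot {u w : E} (hu : ‖u‖ = 1) (hw : ‖w‖ = 1) (z y : Circle) :
    unitaryTrace (rot u z * rot w y) = Module.finrank ℂ E + ((z : ℂ) - 1) + ((y : ℂ) - 1) +
      ((z : ℂ) - 1) * ((y : ℂ) - 1) * ((‖⟪u, w⟫_ℂ‖ : ℂ) ^ 2) := by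
  have hsum (a c : E) : ∑ i, ⟪a, stdOrthonormalBasis ℂ E i⟫_ℂ * ⟪stdOrthonormalBasis ℂ E i, c⟫_ℂ
      = ⟪a, c⟫_ℂ := OrthonormalBasis.sum_inner_mul_inner _ a c
  have hself {a : E} (ha : ‖a‖ = 1) : ⟪a, a⟫_ℂ = 1 := by
    rw [inner_self_eq_norm_sq_to_K, ha]; simp
  rw [unitaryTrace_eq_sum_inner _ (stdOrthonormalBasis ℂ E)]
  have h (x : E) : ⟪x, (rot u z * rot w y) x⟫_ℂ = ⟪x, x⟫_ℂ + ((y : ℂ) - 1) * (⟪w, x⟫_ℂ * ⟪x, w⟫_ℂ)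
      + ((z : ℂ) - 1) * (⟪u, x⟫_ℂ * ⟪x, u⟫_ℂ) +
      ((z : ℂ) - 1) * ((y : ℂ) - 1) * ⟪u, w⟫_ℂ * (⟪w, x⟫_ℂ * ⟪x, u⟫_ℂ) := by
    rw [isometryEquiv_mul_apply, rot_apply hw, rot_apply hu]
    simp only [inner_add_right, inner_smul_right]
    ring
  simp only [h, Finset.sum_add_distrib, ← Finset.mul_sum, hsum, hself hu, hself hw]
  have h1 (i) : ⟪stdOrthonormalBasis ℂ E i, stdOrthonormalBasis ℂ E i⟫_ℂ = 1 :=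
    hself (OrthonormalBasis.norm_eq_one _ i)
  simp only [h1, Finset.sum_const, Finset.card_univ, Fintype.card_fin, nsmul_eq_mul, mul_one]
  rw [← Complex.mul_conj', inner_conj_symm]
  ring

lemma circle_add_inv (z : Circle) : (z : ℂ) + ((z⁻¹ : Circle) : ℂ) = (2 * (z : ℂ).re : ℝ) := by
  rw [Circle.coe_inv_eq_conj, Complex.add_conj]

lemma unitaryTrace_rotPair {u w : E} (hu : ‖u‖ = 1) (hw : ‖w‖ = 1) (z : Circle) :
    unitaryTrace (rotPair u w z) =
      ((Module.finrank ℂ E - 2 * (1 - (z : ℂ).re) * (1 - ‖⟪u, w⟫_ℂ‖ ^ 2) : ℝ) : ℂ) := by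
  rw [rotPair, unitaryTrace_rot_mul_rot hu hw]
  have h1 := circle_add_inv z
  have h2 : (z : ℂ) * ((z⁻¹ : Circle) : ℂ) = 1 := by
    rw [← Circle.coe_mul, mul_inv_cancel, Circle.coe_one]
  generalize ((z⁻¹ : Circle) : ℂ) = z' at h1 h2 ⊢
  push_cast at h1 ⊢
  linear_combination (1 - (‖⟪u, w⟫_ℂ‖ : ℂ) ^ 2) * h1 + (‖⟪u, w⟫_ℂ‖ : ℂ) ^ 2 * h2

lemma card_le_finrank_of_mem {ι : Type*} [Fintype ι] (b : OrthonormalBasis ι ℂ E) (J : Finset ι)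
    (S : Submodule ℂ E) (h : ∀ i ∈ J, b i ∈ S) : J.card ≤ Module.finrank ℂ S := by
  have hli : LinearIndependent ℂ (fun i : J => (⟨b i, h i i.2⟩ : S)) :=
    LinearIndependent.of_comp S.subtype
      (b.orthonormal.linearIndependent.comp (fun i : J => (i : ι)) Subtype.val_injective)
  simpa using hli.fintype_card_le_finrank

lemma finrank_span_pair_le (a c : E) : Module.finrank ℂ (Submodule.span ℂ {a, c}) ≤ 2 := by
  classical
  have h := finrank_span_finset_le_card (R := ℂ) ({a, c} : Finset E)
  rw [Finset.coe_pair] at h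
  exact h.trans Finset.card_le_two

lemma rotPair_apply_sub_mem {a c : E} (ha : ‖a‖ = 1) (hc : ‖c‖ = 1) (z : Circle) (x : E) :
    rotPair a c z x - x ∈ Submodule.span ℂ {a, c} := by
  rw [rotPair, isometryEquiv_mul_apply, rot_apply ha, rot_apply hc, add_assoc, add_sub_cancel_left]
  exact add_mem (Submodule.smul_mem _ _ (Submodule.subset_span (by simp)))
    (Submodule.smul_mem _ _ (Submodule.subset_span (by simp)))

/-- Products of two complex reflections with inverse angles are conjugate to diagonal ones. -/
theorem exists_rotPair_eq (hn : 2 ≤ Module.finrank ℂ E) {a c : E} (ha : ‖a‖ = 1) (hc : ‖c‖ = 1)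
    (z : Circle) : ∃ (u w : E) (v : Circle), ‖u‖ = 1 ∧ ‖w‖ = 1 ∧ ⟪u, w⟫_ℂ = 0 ∧
      rotPair a c z = rotPair u w v ∧
      1 - (v : ℂ).re = (1 - (z : ℂ).re) * (1 - ‖⟪a, c⟫_ℂ‖ ^ 2) := by
  classical
  obtain ⟨b, μ, hb⟩ := exists_eq_diagHom (rotPair a c z)
  -- The product differs from the identity by a map into span {a, c}, so at most two eigenvalues
  -- differ from 1. They are mutually inverse by the determinant, and the trace fixes their real
  -- part.
  let J : Finset (Fin (Module.finrank ℂ E)) := {i | μ i ≠ 1}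
  have hcard : J.card ≤ 2 := by
    refine (card_le_finrank_of_mem b J (Submodule.span ℂ {a, c}) fun i hi => ?_).trans
      (finrank_span_pair_le a c)
    have hi' : (μ i : ℂ) - 1 ≠ 0 := by
      rw [sub_ne_zero, ne_eq, Circle.coe_eq_one]
      exact (Finset.mem_filter.1 hi).2
    rw [← Submodule.smul_mem_iff _ hi', sub_smul, one_smul, ← diagHom_apply_basis, ← hb]
    exact rotPair_apply_sub_mem ha hc z (b i)
  obtain ⟨t, hJt, ht⟩ := Finset.exists_superset_card_eq hcard (by simpa using hn)
  obtain ⟨i, j, hij, rfl⟩ := Finset.card_eq_two.1 ht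
  have hμ1 (k) (hki : k ≠ i) (hkj : k ≠ j) : μ k = 1 := by
    by_contra hk
    have : k ∈ J := Finset.mem_filter.2 ⟨Finset.mem_univ k, hk⟩
    have := hJt this
    simp [hki, hkj] at this
  have hprod : μ i * μ j = 1 := by
    have h1 := rotPair_mem_specialUnitary ha hc z
    rw [hb, mem_specialUnitary, unitaryDet_diagHom, ← coe_prod_circle, Circle.coe_eq_one] at h1
    rw [← h1, ← Finset.prod_pair hij]
    refine Finset.prod_subset (Finset.subset_univ _) fun k _ hk => ?_
    simp only [Finset.mem_insert, Finset.mem_singleton, not_or] at hk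
    exact hμ1 k hk.1 hk.2
  have hμ : μ = Pi.mulSingle i (μ i) * Pi.mulSingle j (μ i)⁻¹ := by
    rw [inv_eq_of_mul_eq_one_right hprod]
    ext k
    by_cases hki : k = i
    · subst hki; simp [hij]
    · by_cases hkj : k = j
      · subst hkj; simp [hki]
      · simp [hki, hkj, hμ1 k hki hkj]
  have hX : rotPair a c z = rotPair (b i) (b j) (μ i) := by
    rw [hb, hμ, map_mul, diagHom_mulSingle, diagHom_mulSingle, rotPair]
    simp [hij]
  have hinner : ⟪b i, b j⟫_ℂ = 0 := b.orthonormal.2 hij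
  refine ⟨b i, b j, μ i, b.norm_eq_one i, b.norm_eq_one j, hinner, hX, ?_⟩
  have h1 := congrArg unitaryTrace hX
  rw [unitaryTrace_rotPair ha hc, unitaryTrace_rotPair (b.norm_eq_one i) (b.norm_eq_one j),
    Complex.ofReal_inj, hinner] at h1
  simp only [norm_zero] at h1
  linarith

end Generation

/-! ### Subgroups normalised by SU(E): scalar or large -/

section Normal

variable {E : Type*} [NormedAddCommGroup E] [InnerProductSpace ℂ E] [FiniteDimensional ℂ E]

/-- This removes scalar ambiguities throughout: determinants give the exponent n = dim, order p
modulo scalars gives the exponent p, and p > n makes the two coprime. -/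
lemma circle_eq_one_of_pow_eq_one {c : Circle} {n p : ℕ} (hp : p.Prime) (hn : n ≠ 0) (hnp : n < p)
    (h1 : c ^ n = 1) (h2 : c ^ p = 1) : c = 1 := by
  have h : Nat.Coprime n p := (Nat.coprime_of_lt_prime hn hnp hp).symm
  have := pow_gcd_eq_one.2 ⟨h1, h2⟩
  rwa [h, pow_one] at this

lemma exists_circle_root {p : ℕ} (hp : p.Prime) : ∃ ζ : Circle, ζ ≠ 1 ∧ ζ ^ p = 1 := by
  have hp0 : (p : ℝ) ≠ 0 := by exact_mod_cast hp.ne_zero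
  refine ⟨Circle.exp (2 * Real.pi / p), fun h => ?_, ?_⟩
  · obtain ⟨m, hm⟩ := Circle.exp_eq_one.1 h
    have h1 : (1 : ℝ) = m * p := by
      have hpi := Real.two_pi_pos.ne'
      rw [div_eq_iff hp0, mul_right_comm] at hm
      exact mul_right_cancel₀ hpi (by linarith)
    have h2 : (1 : ℤ) = m * p := by exact_mod_cast h1
    have h3 : (p : ℤ) ∣ 1 := ⟨m, by rw [h2]; ring⟩
    exact hp.one_lt.ne' (by exact_mod_cast Int.eq_one_of_dvd_one (by positivity) h3)
  · rw [← Circle.exp_nsmul, nsmul_eq_mul, mul_div_cancel₀ _ hp0, Circle.exp_two_pi]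

lemma phase_injective [Nontrivial E] : Function.Injective (phase E) := by
  rw [injective_iff_map_eq_one]
  intro c hc
  obtain ⟨x, hx⟩ := exists_ne (0 : E)
  have h := phase_apply c x
  rw [hc] at h
  have h1 : ((c : ℂ) - 1) • x = 0 := by rw [sub_smul, ← h, one_smul, sub_eq_zero]; rfl
  have h2 := (smul_eq_zero.1 h1).resolve_right hx
  exact Circle.coe_eq_one.1 (sub_eq_zero.1 h2)

lemma circle_pow_finrank_eq_one_of_det {c : Circle} (h : unitaryDet (phase E c) = 1) :
    c ^ Module.finrank ℂ E = 1 := by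
  rw [unitaryDet_phase] at h
  exact Circle.ext (by rw [Circle.coe_pow, h, Circle.coe_one])

lemma commute_of_mem_phase_range {X : E ≃ₗᵢ[ℂ] E} (hX : X ∈ (phase E).range) (Y : E ≃ₗᵢ[ℂ] E) :
    Commute X Y := by
  obtain ⟨c, rfl⟩ := hX
  exact phase_comm c Y

/-- An element of prime order `p > dim E` modulo scalars that commutes modulo scalars with `X`
commutes with `X`. -/
lemma commute_of_commutator_mem {p : ℕ} (hp : p.Prime) (hn : Module.finrank ℂ E < p)
    {X R : E ≃ₗᵢ[ℂ] E} (hR : R ^ p ∈ (phase E).range) (h : ⁅X, R⁆ ∈ (phase E).range) :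
    Commute X R := by
  rcases subsingleton_or_nontrivial E with hE | hE
  · exact LinearIsometryEquiv.ext fun x => Subsingleton.elim _ _
  obtain ⟨c, hc⟩ := h
  suffices hc1 : c = 1 by
    rw [hc1, map_one] at hc
    exact commutatorElement_eq_one_iff_commute.1 hc.symm
  apply circle_eq_one_of_pow_eq_one hp Module.finrank_pos.ne' hn
  · apply circle_pow_finrank_eq_one_of_det
    rw [hc]
    exact commutator_mem_specialUnitary X R
  -- Conjugation by `X` multiplies `R` by `c` but fixes the scalar `R ^ p`.
  · have h1 : X * R * X⁻¹ = phase E c * R := by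
      rw [hc, commutatorElement_def]; group
    have h2 : (X * R * X⁻¹) ^ p = R ^ p := by
      rw [conj_pow, ← (commute_of_mem_phase_range hR X).eq, mul_inv_cancel_right]
    rw [h1, (show Commute (phase E c) R from phase_comm c R).mul_pow, mul_eq_right, ← map_pow] at h2
    exact phase_injective (h2.trans (map_one _).symm)

lemma eq_smul_of_rot_eq_rot {u w : E} (hu : ‖u‖ = 1) (hw : ‖w‖ = 1) {z y : Circle} (hy : y ≠ 1)
    (h : rot u z = rot w y) : ∃ c : ℂ, w = c • u := by
  have h1 := DFunLike.congr_fun h w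
  rw [rot_apply hu, rot_apply_self hw] at h1
  have hy' : (y : ℂ) - 1 ≠ 0 := by rwa [sub_ne_zero, ne_eq, Circle.coe_eq_one]
  refine ⟨((y : ℂ) - 1)⁻¹ * (((z : ℂ) - 1) * ⟪u, w⟫_ℂ), ?_⟩
  rw [mul_smul, eq_inv_smul_iff₀ hy', sub_smul, one_smul, ← h1, add_sub_cancel_left]

lemma exists_apply_eq_smul_of_commute_rot {X : E ≃ₗᵢ[ℂ] E} {u : E} (hu : ‖u‖ = 1) {z : Circle}
    (hz : z ≠ 1) (h : Commute X (rot u z)) : ∃ c : ℂ, X u = c • u := by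
  apply eq_smul_of_rot_eq_rot hu (by rw [X.norm_map, hu]) hz
  rw [← conj_rot X hu, h.eq, mul_inv_cancel_right]

lemma rot_pow_eq_one (u : E) {p : ℕ} {ζ : Circle} (h : ζ ^ p = 1) : rot u ζ ^ p = 1 := by
  rw [← map_pow, h, map_one]

lemma exists_apply_eq_smul_of_commutator_mem {p : ℕ} (hp : p.Prime) (hn : Module.finrank ℂ E < p)
    {X : E ≃ₗᵢ[ℂ] E} {u : E} (hu : ‖u‖ = 1) {ζ : Circle} (hζ : ζ ≠ 1) (hζp : ζ ^ p = 1)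
    (h : ⁅X, rot u ζ⁆ ∈ (phase E).range) : ∃ c : ℂ, X u = c • u :=
  exists_apply_eq_smul_of_commute_rot hu hζ
    (commute_of_commutator_mem hp hn (by rw [rot_pow_eq_one u hζp]; exact one_mem _) h)

lemma exists_circle_apply_eq_smul {X : E ≃ₗᵢ[ℂ] E} {u : E} (hu : ‖u‖ = 1)
    (h : ∃ c : ℂ, X u = c • u) : ∃ c : Circle, X u = (c : ℂ) • u := by
  obtain ⟨c, hc⟩ := h
  have h1 := congrArg norm hc
  rw [X.norm_map, norm_smul, hu, mul_one] at h1
  exact ⟨⟨c, mem_sphere_zero_iff_norm.2 h1.symm⟩, hc⟩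

/-- If `x`, `y` and `x + y` are eigenvectors then the eigenvalues agree. -/
lemma eigenvalue_eq_of_orthonormal {X : E ≃ₗᵢ[ℂ] E} {x y : E} (hx : ‖x‖ = 1) (hy : ‖y‖ = 1)
    (hxy : ⟪x, y⟫_ℂ = 0) {c d : Circle} (hc : X x = (c : ℂ) • x) (hd : X y = (d : ℂ) • y)
    (h : ∀ r : ℂ, ‖r • (x + y)‖ = 1 → ∃ e : ℂ, X (r • (x + y)) = e • (r • (x + y))) : c = d := by
  have hyx : ⟪y, x⟫_ℂ = 0 := inner_eq_zero_symm.1 hxy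
  have hxx : ⟪x, x⟫_ℂ = 1 := by rw [inner_self_eq_norm_sq_to_K, hx]; simp
  have hyy : ⟪y, y⟫_ℂ = 1 := by rw [inner_self_eq_norm_sq_to_K, hy]; simp
  have hne : x + y ≠ 0 := by
    intro h0
    have : ⟪x, x + y⟫_ℂ = 1 := by rw [inner_add_right, hxx, hxy, add_zero]
    rw [h0, inner_zero_right] at this
    exact zero_ne_one this
  have hn : ‖x + y‖ ≠ 0 := norm_ne_zero_iff.2 hne
  have hr : ((‖x + y‖ : ℂ)⁻¹) ≠ 0 := inv_ne_zero (by exact_mod_cast hn)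
  obtain ⟨e, he⟩ := h (‖x + y‖ : ℂ)⁻¹ (by
    rw [norm_smul, norm_inv, Complex.norm_real, norm_norm, inv_mul_cancel₀ hn])
  rw [map_smul, smul_comm, (smul_right_injective E hr).eq_iff, map_add, hc, hd] at he
  have h1 := congrArg (fun v => ⟪x, v⟫_ℂ) he
  have h2 := congrArg (fun v => ⟪y, v⟫_ℂ) he
  simp only [inner_add_right, inner_smul_right, hxx, hyy, hxy, hyx, mul_one, mul_zero, add_zero,
    zero_add] at h1 h2
  exact Circle.ext (h1.trans h2.symm)

/-- Two orthonormal eigenvectors orthogonal to `w` share their eigenvalue because their sum is again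
an eigenvector; so `X` is scalar on the complement of `w`. -/
lemma exists_eq_phase_mul_rot {X : E ≃ₗᵢ[ℂ] E} {w : E} (hw : ‖w‖ = 1) (hXw : ∃ c : ℂ, X w = c • w)
    (h : ∀ x : E, ‖x‖ = 1 → ⟪w, x⟫_ℂ = 0 → ∃ c : ℂ, X x = c • x) :
    ∃ c z : Circle, X = phase E c * rot w z := by
  obtain ⟨b, i, rfl⟩ := exists_basis_apply_eq hw
  obtain ⟨d, hd⟩ := exists_circle_apply_eq_smul hw hXw
  have hinner (j) (hj : j ≠ i) : ⟪b i, b j⟫_ℂ = 0 := b.orthonormal.2 hj.symm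
  obtain ⟨c, hc⟩ : ∃ c : Circle, ∀ j, j ≠ i → X (b j) = (c : ℂ) • b j := by
    by_cases hj : ∃ j, j ≠ i
    · obtain ⟨j, hj⟩ := hj
      obtain ⟨c, hc⟩ := exists_circle_apply_eq_smul (b.norm_eq_one j)
        (h _ (b.norm_eq_one j) (hinner j hj))
      refine ⟨c, fun k hk => ?_⟩
      rcases eq_or_ne j k with rfl | hjk
      · exact hc
      obtain ⟨e, he⟩ := exists_circle_apply_eq_smul (b.norm_eq_one k)
        (h _ (b.norm_eq_one k) (hinner k hk))
      rw [he, eigenvalue_eq_of_orthonormal (b.norm_eq_one j) (b.norm_eq_one k)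
        (b.orthonormal.2 hjk) hc he fun r hr => h _ hr (by
          rw [inner_smul_right, inner_add_right, hinner j hj, hinner k hk, add_zero, mul_zero])]
    -- In dimension one the complement is zero and any scalar serves.
    · exact ⟨1, fun j hj' => (hj ⟨j, hj'⟩).elim⟩
  refine ⟨c, d * c⁻¹, ext_basis b fun j => ?_⟩
  rw [isometryEquiv_mul_apply, phase_apply]
  rcases eq_or_ne j i with rfl | hj
  · rw [hd, rot_apply_self hw, smul_smul, ← Circle.coe_mul, mul_comm d, mul_inv_cancel_left]
  · rw [hc j hj, rot_apply_of_inner_eq_zero hw (hinner j hj)]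

lemma mem_phase_range_of_forall_eigenvector {X : E ≃ₗᵢ[ℂ] E}
    (h : ∀ x : E, ‖x‖ = 1 → ∃ c : ℂ, X x = c • x) : X ∈ (phase E).range := by
  rcases subsingleton_or_nontrivial E with hE | hE
  · exact ⟨1, LinearIsometryEquiv.ext fun x => Subsingleton.elim _ _⟩
  set b := stdOrthonormalBasis ℂ E
  have hex (i) := exists_circle_apply_eq_smul (b.norm_eq_one i) (h _ (b.norm_eq_one i))
  choose μ hμ using hex
  let i₀ : Fin (Module.finrank ℂ E) := ⟨0, Module.finrank_pos⟩
  refine ⟨μ i₀, ext_basis b fun j => ?_⟩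
  rw [phase_apply, hμ j]
  rcases eq_or_ne i₀ j with hj | hj
  · rw [hj]
  · rw [eigenvalue_eq_of_orthonormal (b.norm_eq_one i₀) (b.norm_eq_one j) (b.orthonormal.2 hj)
      (hμ i₀) (hμ j) fun r hr => h _ hr]

lemma commutator_phase_mul (X Y : E ≃ₗᵢ[ℂ] E) (c : Circle) : ⁅X, phase E c * Y⁆ = ⁅X, Y⁆ := by
  have h : ⁅X, phase E c * Y⁆ = X * phase E c * Y * X⁻¹ * Y⁻¹ * (phase E c)⁻¹ := by
    rw [commutatorElement_def]; group
  rw [h, ← phase_comm c X, commutatorElement_def, mul_inv_eq_iff_eq_mul, ← phase_comm c]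
  simp only [mul_assoc]

lemma commutator_phase_mul_left (X Y : E ≃ₗᵢ[ℂ] E) (c : Circle) : ⁅phase E c * X, Y⁆ = ⁅X, Y⁆ := by
  rw [← commutatorElement_inv, commutator_phase_mul, commutatorElement_inv]

/-- A unitary commuting modulo scalars with the special unitary group is a scalar. -/
lemma mem_phase_range_of_commutator_mem {X : E ≃ₗᵢ[ℂ] E}
    (h : ∀ s ∈ specialUnitary E, ⁅X, s⁆ ∈ (phase E).range) : X ∈ (phase E).range := by
  apply mem_phase_range_of_forall_eigenvector
  intro u hu
  have : Nontrivial E := ⟨u, 0, fun h => by simp [h] at hu⟩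
  obtain ⟨p, hp1, hp⟩ := Nat.exists_infinite_primes (Module.finrank ℂ E + 1)
  obtain ⟨ζ, hζ, hζp⟩ := exists_circle_root hp
  obtain ⟨c, hc⟩ := exists_phase_mul_mem_specialUnitary (rot u ζ)
  have h1 := h _ hc
  rw [commutator_phase_mul] at h1
  exact exists_apply_eq_smul_of_commutator_mem hp hp1 hu hζ hζp h1

lemma conj_mem_of_conj_mem {N : Subgroup (E ≃ₗᵢ[ℂ] E)}
    (hN : ∀ s ∈ specialUnitary E, ∀ x ∈ N, s * x * s⁻¹ ∈ N) (v : E ≃ₗᵢ[ℂ] E) {x : E ≃ₗᵢ[ℂ] E}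
    (hx : x ∈ N) : v * x * v⁻¹ ∈ N := by
  rcases subsingleton_or_nontrivial E with hE | hE
  · rwa [show v * x * v⁻¹ = x from LinearIsometryEquiv.ext fun x => Subsingleton.elim _ _]
  obtain ⟨c, hc⟩ := exists_phase_mul_mem_specialUnitary v
  have := hN _ hc x hx
  rwa [conj_phase_mul] at this

lemma exists_circle_re_eq {r : ℝ} (h1 : -1 ≤ r) (h2 : r ≤ 1) : ∃ z : Circle, (z : ℂ).re = r :=
  ⟨Circle.exp (Real.arccos r), by
    rw [Circle.coe_exp, Complex.exp_ofReal_mul_I_re, Real.cos_arccos h1 h2]⟩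

lemma circle_eq_or_eq_inv_of_re_eq {z w : Circle} (h : (z : ℂ).re = (w : ℂ).re) :
    z = w ∨ z = w⁻¹ := by
  have h1 := Circle.normSq_coe z
  have h2 := Circle.normSq_coe w
  rw [Complex.normSq_apply] at h1 h2
  have h3 : (z : ℂ).im ^ 2 = (w : ℂ).im ^ 2 := by rw [h] at h1; linarith
  rcases sq_eq_sq_iff_eq_or_eq_neg.1 h3 with h4 | h4
  · exact Or.inl (Circle.ext (Complex.ext h h4))
  · exact Or.inr (Circle.ext (by
      rw [Circle.coe_inv_eq_conj]; exact Complex.ext h h4))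

lemma circle_re_le_one (z : Circle) : (z : ℂ).re ≤ 1 :=
  (Complex.re_le_norm _).trans_eq (Circle.norm_coe z)

lemma neg_one_le_circle_re (z : Circle) : -1 ≤ (z : ℂ).re := by
  have := (abs_le.1 (Complex.abs_re_le_norm (z : ℂ))).1
  rwa [Circle.norm_coe] at this

/-- A root of large order lies close to 1; it reduces generation by all angles to generation by
small angles. -/
lemma exists_pow_eq_re_close (z : Circle) {δ : ℝ} (hδ : 0 < δ) :
    ∃ (y : Circle) (k : ℕ), y ^ k = z ∧ 1 - δ ≤ (y : ℂ).re := by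
  obtain ⟨t, rfl⟩ := Circle.exp_surjective z
  obtain ⟨k, hk⟩ := exists_nat_gt (t ^ 2 / δ + 1)
  have hk1 : (1 : ℝ) < k := by
    have : 0 ≤ t ^ 2 / δ := by positivity
    linarith
  have hk0 : (k : ℝ) ≠ 0 := by positivity
  refine ⟨Circle.exp (t / k), k, ?_, ?_⟩
  · rw [← Circle.exp_nsmul, nsmul_eq_mul, mul_div_cancel₀ _ hk0]
  · rw [Circle.coe_exp, Complex.exp_ofReal_mul_I_re]
    refine le_trans ?_ (Real.one_sub_sq_div_two_le_cos)
    have h1 : t ^ 2 < δ * k := by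
      have : t ^ 2 / δ < k := by linarith
      rw [div_lt_iff₀ hδ] at this
      linarith
    have h2 : (t / k) ^ 2 ≤ δ := by
      rw [div_pow, div_le_iff₀ (by positivity)]
      nlinarith
    linarith

/-- A subgroup normalised by the special unitary group that contains a non-scalar element contains
the special unitary group. -/
theorem specialUnitary_le_of_not_mem_phase_range {N : Subgroup (E ≃ₗᵢ[ℂ] E)}
    (hN : ∀ s ∈ specialUnitary E, ∀ x ∈ N, s * x * s⁻¹ ∈ N) {x : E ≃ₗᵢ[ℂ] E} (hx : x ∈ N)
    (hxs : x ∉ (phase E).range) : specialUnitary E ≤ N := by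
  obtain ⟨a, ha, hxa⟩ : ∃ a : E, ‖a‖ = 1 ∧ ∀ c : ℂ, x a ≠ c • a := by
    by_contra! h
    exact hxs (mem_phase_range_of_forall_eigenvector h)
  have hxa1 : ‖x a‖ = 1 := by rw [x.norm_map, ha]
  have hlt : ‖⟪x a, a⟫_ℂ‖ < 1 := by
    refine lt_of_le_of_ne ?_ fun h => ?_
    · simpa [ha, hxa1] using norm_inner_le_norm (𝕜 := ℂ) (x a) a
    · rw [norm_inner_symm] at h
      have h1 : ‖⟪a, x a⟫_ℂ‖ = ‖a‖ * ‖x a‖ := by rw [h, ha, hxa1, one_mul]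
      have ha0 : a ≠ 0 := by rintro rfl; simp at ha
      have hx0 : x a ≠ 0 := fun h0 => by rw [h0, norm_zero] at hxa1; exact zero_ne_one hxa1
      obtain ⟨r, -, hr⟩ := (norm_inner_eq_norm_iff ha0 hx0).1 h1
      exact hxa r hr
  set δ : ℝ := 1 - ‖⟪x a, a⟫_ℂ‖ ^ 2 with hδ
  have hδ0 : 0 < δ := by nlinarith [norm_nonneg ⟪x a, a⟫_ℂ]
  apply specialUnitary_le_of_rotPair_mem
  intro u w hu hw huw v
  have hn : 2 ≤ Module.finrank ℂ E := by
    simpa using (orthonormal_vec_two hu hw huw).linearIndependent.fintype_card_le_finrank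
  -- The commutator of `x` with `rot a z` is `rotPair (x a) a z`, conjugate to an orthogonal pair
  -- whose angle `y'` satisfies 1 - Re y' = δ (1 - Re z). Every `y` with 1 - Re y ≤ δ is reached, so
  -- it suffices to take a root `y` of `v` that close to 1.
  obtain ⟨y, k, rfl, hy⟩ := exists_pow_eq_re_close v hδ0
  rw [← rotPair_pow hu hw huw]
  apply pow_mem
  have hy1 := circle_re_le_one y
  obtain ⟨z, hz⟩ := exists_circle_re_eq (r := 1 - (1 - (y : ℂ).re) / δ)
    (by
      have : (1 - (y : ℂ).re) / δ ≤ 1 := by rw [div_le_one hδ0]; linarith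
      linarith)
    (by
      have : 0 ≤ (1 - (y : ℂ).re) / δ := div_nonneg (by linarith) hδ0.le
      linarith)
  obtain ⟨u', w', y', hu', hw', huw', heq, hre⟩ := exists_rotPair_eq hn hxa1 ha z
  have hmem : rotPair (x a) a z ∈ N := by
    have h1 := mul_mem hx (conj_mem_of_conj_mem hN (rot a z) (inv_mem hx))
    have h2 : x * (rot a z * x⁻¹ * (rot a z)⁻¹) = rotPair (x a) a z := by
      rw [rotPair, ← conj_rot x ha, map_inv]; group
    rwa [h2] at h1
  have hyy : (y' : ℂ).re = (y : ℂ).re := by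
    rw [← hδ, hz] at hre
    have : (1 - (1 - (1 - (y : ℂ).re) / δ)) * δ = 1 - (y : ℂ).re := by field_simp; ring
    linarith
  rw [heq] at hmem
  -- The real part leaves the angle known up to inversion, which amounts to exchanging the two
  -- lines.
  rcases circle_eq_or_eq_inv_of_re_eq hyy with rfl | rfl
  · obtain ⟨g, hg1, hg2⟩ := exists_map_pair hu' hw' huw' hu hw huw
    have := conj_mem_of_conj_mem hN g hmem
    rwa [conj_rotPair g hu' hw', hg1, hg2] at this
  · rw [rotPair_inv_right hu' hw' huw'] at hmem
    obtain ⟨g, hg1, hg2⟩ := exists_map_pair hw' hu' (inner_eq_zero_symm.1 huw') hu hw huw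
    have := conj_mem_of_conj_mem hN g hmem
    rwa [conj_rotPair g hw' hu', hg1, hg2] at this

end Normal

/-! ### Recognising reflections by counting commuting conjugates -/

section Counting

lemma apply_swap_ne_iff {ι α : Type*} [DecidableEq ι] {χ : ι → α} {k l : ι} (h : χ k ≠ χ l) (m : ι) :
    χ (Equiv.swap k l m) ≠ χ m ↔ m = k ∨ m = l := by
  rcases eq_or_ne m k with rfl | hk
  · simpa using h.symm
  rcases eq_or_ne m l with rfl | hl
  · simpa using h
  simp [Equiv.swap_apply_of_ne_of_ne hk hl, hk, hl]

/-- A non-constant function on `ι` has at least `#ι` distinct rearrangements, and at least one more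
unless it is constant off one point. -/
lemma exists_injective_rearrangements {ι α : Type*} [DecidableEq ι] {χ : ι → α} {i j : ι}
    (hij : χ i ≠ χ j) :
    (∃ τ : ι → Equiv.Perm ι, Function.Injective fun k => χ ∘ τ k) ∧
    ((∀ i, ∃ k l, k ≠ i ∧ l ≠ i ∧ χ k ≠ χ l) →
      ∃ τ : Option ι → Equiv.Perm ι, Function.Injective fun k => χ ∘ τ k) := by
  classical
  -- The pairs {k, par k} with k ≠ i are the edges of a tree joining indices with different values.
  -- Swapping along an edge changes `χ` exactly at its two ends, so the edges together with the
  -- identity (the case k = i) give #ι distinct rearrangements.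
  let par : ι → ι := fun k => if k = i then i else if χ k = χ i then j else i
  have hpar (k : ι) (hk : k ≠ i) : χ k ≠ χ (par k) := by
    simp only [par, if_neg hk]
    split_ifs with h
    · rwa [h]
    · exact h
  have hkey (k m : ι) : χ (Equiv.swap k (par k) m) ≠ χ m ↔ k ≠ i ∧ (m = k ∨ m = par k) := by
    rcases eq_or_ne k i with rfl | hk
    · simp [par]
    · rw [apply_swap_ne_iff (hpar k hk)]
      simp [hk]
  have hinj : Function.Injective fun k => χ ∘ (Equiv.swap k (par k)) := by
    intro k l hkl
    have h (m : ι) : (k ≠ i ∧ (m = k ∨ m = par k)) ↔ (l ≠ i ∧ (m = l ∨ m = par l)) := by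
      rw [← hkey, ← hkey]
      exact not_congr (by rw [show χ (Equiv.swap k (par k) m) = χ (Equiv.swap l (par l) m) from
        congrFun hkl m])
    have hk := h k
    have hl := h l
    grind
  refine ⟨⟨_, hinj⟩, fun hstar => ?_⟩
  -- One more rearrangement comes from a pair with different values that is not an edge. If some k ≠
  -- i shares the value of i, take l ≠ j with another value; otherwise the tree is a star at i, and
  -- two other indices with different values work.
  obtain ⟨k, l, hkl, hne⟩ : ∃ k l, χ k ≠ χ l ∧ ∀ m, m ≠ i → ¬ ((k = m ∨ k = par m) ∧
      (l = m ∨ l = par m)) := by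
    by_cases h1 : ∃ k, k ≠ i ∧ χ k = χ i
    · obtain ⟨k, hk, hki⟩ := h1
      obtain ⟨l, hl, hli⟩ : ∃ l, l ≠ j ∧ χ l ≠ χ i := by
        by_contra! h2
        obtain ⟨k', l', hk', hl', hne⟩ := hstar j
        exact hne ((h2 k' hk').trans (h2 l' hl').symm)
      refine ⟨k, l, by rw [hki]; exact hli.symm, fun m hm => ?_⟩
      simp only [par, if_neg hm]
      grind
    · push Not at h1
      obtain ⟨k, l, hk, hl, hne⟩ := hstar i
      refine ⟨k, l, hne, fun m hm => ?_⟩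
      simp only [par, if_neg hm, if_neg (h1 m hm)]
      grind
  refine ⟨fun o => o.elim (Equiv.swap k l) fun k => Equiv.swap k (par k), ?_⟩
  have hnone (m : ι) : χ ∘ Equiv.swap k l ≠ χ ∘ Equiv.swap m (par m) := by
    intro h
    have h' (x : ι) : (x = k ∨ x = l) ↔ (m ≠ i ∧ (x = m ∨ x = par m)) := by
      rw [← hkey, ← apply_swap_ne_iff hkl]
      exact not_congr (by rw [show χ (Equiv.swap k l x) = χ (Equiv.swap m (par m) x) from
        congrFun h x])
    have hk := (h' k).1 (Or.inl rfl)
    have hl := (h' l).1 (Or.inr rfl)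
    exact hne m hk.1 ⟨hk.2, hl.2⟩
  rintro (_ | m) (_ | m') h
  · rfl
  · exact (hnone m' h).elim
  · exact (hnone m h.symm).elim
  · exact congrArg some (hinj h)

/-- There are `N` conjugates of `x` that are pairwise distinct and commute modulo `K`. -/
def HasCommutingConjugates {T : Type*} [Group T] (K : Subgroup T) (x : T) (N : ℕ) : Prop :=
  ∃ g : Fin N → T, (∀ i j, ⁅g i * x * (g i)⁻¹, g j * x * (g j)⁻¹⁆ ∈ K) ∧
    ∀ i j, i ≠ j → (g i * x * (g i)⁻¹) * (g j * x * (g j)⁻¹)⁻¹ ∉ K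

variable {E : Type*} [NormedAddCommGroup E] [InnerProductSpace ℂ E] [FiniteDimensional ℂ E]

/-- Commuting makes `w` an eigenvector of `rot u z`, but `rot u z w - w` is a multiple of `u`,
nonzero unless `u` and `w` are orthogonal. -/
lemma inner_eq_zero_or_parallel {u w : E} (hu : ‖u‖ = 1) (hw : ‖w‖ = 1) {z y : Circle}
    (hz : z ≠ 1) (hy : y ≠ 1) (h : Commute (rot u z) (rot w y)) :
    ⟪u, w⟫_ℂ = 0 ∨ ∃ c : ℂ, c ≠ 0 ∧ u = c • w := by
  obtain ⟨c, hc⟩ := exists_apply_eq_smul_of_commute_rot hw hy h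
  rw [rot_apply hu] at hc
  refine or_iff_not_imp_left.2 fun hne => ?_
  have hz' : (z : ℂ) - 1 ≠ 0 := by rwa [sub_ne_zero, ne_eq, Circle.coe_eq_one]
  have h1 : ((z : ℂ) - 1) * ⟪u, w⟫_ℂ ≠ 0 := mul_ne_zero hz' hne
  have h2 : u = ((((z : ℂ) - 1) * ⟪u, w⟫_ℂ)⁻¹ * (c - 1)) • w := by
    rw [mul_smul, eq_inv_smul_iff₀ h1, sub_smul, one_smul, ← hc, add_sub_cancel_left]
  refine ⟨_, fun h0 => ?_, h2⟩
  rw [h0, zero_smul] at h2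
  simp [h2] at hu

lemma rot_mem_phase_range (hn : 2 ≤ Module.finrank ℂ E) {u : E} (hu : ‖u‖ = 1) {z : Circle}
    (h : rot u z ∈ (phase E).range) : z = 1 := by
  obtain ⟨c, hc⟩ := h
  obtain ⟨w, hw, huw⟩ := exists_unit_inner_eq_zero hn hu
  have h1 := DFunLike.congr_fun hc w
  have h2 := DFunLike.congr_fun hc u
  have hw0 : w ≠ 0 := by rintro rfl; simp at hw
  have hu0 : u ≠ 0 := by rintro rfl; simp at hu
  rw [phase_apply, rot_apply_of_inner_eq_zero hu huw] at h1
  rw [phase_apply, rot_apply_self hu] at h2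
  have h3 : (c : ℂ) = 1 := smul_left_injective ℂ hw0 (h1.trans (one_smul ℂ w).symm)
  have h4 : (c : ℂ) = z := smul_left_injective ℂ hu0 h2
  exact Circle.coe_eq_one.1 (h4.symm.trans h3)

lemma phase_mul_mem_range_iff (c : Circle) (v : E ≃ₗᵢ[ℂ] E) :
    phase E c * v ∈ (phase E).range ↔ v ∈ (phase E).range :=
  Subgroup.mul_mem_cancel_left _ ⟨c, rfl⟩

lemma phase_mul_rot_pow (c z : Circle) (u : E) (k : ℕ) :
    (phase E c * rot u z) ^ k = phase E (c ^ k) * rot u (z ^ k) := by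
  rw [(show Commute (phase E c) (rot u z) from phase_comm c _).mul_pow, map_pow, map_pow]

variable {T : Type*} [Group T] {K : Subgroup T} {a : T →* (E ≃ₗᵢ[ℂ] E)}

lemma map_conj_eq {x g : T} {c z : Circle} {u : E} (hu : ‖u‖ = 1) (hx : a x = phase E c * rot u z) :
    a (g * x * g⁻¹) = phase E c * rot (a g u) z := by
  rw [map_mul, map_mul, map_inv, hx, ← conj_rot (a g) hu, ← mul_assoc, ← phase_comm]
  group

/-- The conjugates are reflections in the lines of `a (g i) u`. Commuting modulo scalars means
commuting, as p > dim, so distinct lines are orthogonal and there are at most dim E of them. -/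
lemma HasCommutingConjugates.le_finrank (hK : ∀ t, t ∈ K ↔ a t ∈ (phase E).range) {p : ℕ}
    (hp : p.Prime) (hnp : Module.finrank ℂ E < p) {x : T} {c ζ : Circle} {u : E} (hu : ‖u‖ = 1)
    (hζ : ζ ≠ 1) (hζp : ζ ^ p = 1) (hx : a x = phase E c * rot u ζ) {N : ℕ}
    (h : HasCommutingConjugates K x N) : N ≤ Module.finrank ℂ E := by
  obtain ⟨g, hg1, hg2⟩ := h
  have hnorm (i) : ‖a (g i) u‖ = 1 := by rw [LinearIsometryEquiv.norm_map, hu]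
  have horth : Orthonormal ℂ fun i => a (g i) u := by
    refine ⟨hnorm, fun i j hij => ?_⟩
    have h1 := (hK _).1 (hg1 i j)
    rw [map_commutatorElement, map_conj_eq hu hx, map_conj_eq hu hx, commutator_phase_mul,
      commutator_phase_mul_left] at h1
    have h2 := commute_of_commutator_mem hp hnp
      (by rw [rot_pow_eq_one _ hζp]; exact one_mem _) h1
    refine (inner_eq_zero_or_parallel (hnorm i) (hnorm j) hζ hζ h2).resolve_right ?_
    rintro ⟨r, hr, hr'⟩
    refine hg2 i j hij ((hK _).2 ?_)
    rw [map_mul, map_inv, map_conj_eq hu hx, map_conj_eq hu hx, hr', rot_smul hr, mul_inv_cancel]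
    exact one_mem _
  simpa using horth.linearIndependent.fintype_card_le_finrank

/-- Permuting the eigenbasis conjugates `x` to diagonal, hence commuting, elements. If two agreed up
to a scalar c, comparing the products of their entries would give c ^ dim = 1, and comparing p-th
powers c ^ p = 1, so c = 1. -/
lemma hasCommutingConjugates_of_injective (hK : ∀ t, t ∈ K ↔ a t ∈ (phase E).range)
    (ha : ∀ v, ∃ t c, a t = phase E c * v) {p : ℕ} (hp : p.Prime) (hnp : Module.finrank ℂ E < p)
    {x : T} (hxp : x ^ p ∈ K) {b : OrthonormalBasis (Fin (Module.finrank ℂ E)) ℂ E}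
    {χ : Fin (Module.finrank ℂ E) → Circle} (hx : a x = diagHom b χ) {N : ℕ}
    {τ : Fin N → Equiv.Perm (Fin (Module.finrank ℂ E))}
    (hτ : Function.Injective fun k => χ ∘ τ k) : HasCommutingConjugates K x N := by
  rcases subsingleton_or_nontrivial E with hE | hE
  · have h0 : IsEmpty (Fin (Module.finrank ℂ E)) := by
      rw [Module.finrank_zero_of_subsingleton]; infer_instance
    have hN : Subsingleton (Fin N) := ⟨fun i j => hτ (Subsingleton.elim _ _)⟩
    exact ⟨fun _ => 1, fun i j => by simp, fun i j hij => (hij (Subsingleton.elim _ _)).elim⟩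
  have hconj (k : Fin N) : ∃ g : T, a (g * x * g⁻¹) = diagHom b (χ ∘ τ k) := by
    obtain ⟨g, c, hg⟩ := ha (b.equiv b (τ k).symm)
    refine ⟨g, ?_⟩
    rw [map_mul, map_mul, map_inv, hg, conj_phase_mul, hx, mul_inv_eq_iff_eq_mul]
    refine ext_basis b fun i => ?_
    rw [isometryEquiv_mul_apply, isometryEquiv_mul_apply, diagHom_apply_basis, map_smul,
      OrthonormalBasis.equiv_apply_basis, diagHom_apply_basis, Function.comp_apply,
      Equiv.apply_symm_apply]
  choose g hg using hconj
  have hconst : ∃ d : Circle, ∀ i, χ i ^ p = d := by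
    obtain ⟨d, hd⟩ := (hK _).1 hxp
    refine ⟨d, fun i => ?_⟩
    have h1 := DFunLike.congr_fun hd (b i)
    have hb0 : b i ≠ 0 := b.orthonormal.ne_zero i
    rw [map_pow, hx, ← map_pow, phase_apply, diagHom_apply_basis] at h1
    exact (Circle.ext (smul_left_injective ℂ hb0 h1)).symm
  obtain ⟨d, hd⟩ := hconst
  refine ⟨g, fun i j => (hK _).2 ?_, fun i j hij hmem => hij (hτ ?_)⟩
  · rw [map_commutatorElement, hg, hg, ← map_commutatorElement,
      commutatorElement_eq_one_iff_commute.2 (Commute.all _ _), map_one]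
    exact one_mem _
  · obtain ⟨c, hc⟩ := (hK _).1 hmem
    rw [map_mul, map_inv, hg, hg, ← map_inv, ← map_mul] at hc
    have hck (k) : χ (τ i k) = c * χ (τ j k) := by
      have h1 := DFunLike.congr_fun hc (b k)
      rw [phase_apply, diagHom_apply_basis] at h1
      have h2 := Circle.ext (smul_left_injective ℂ (b.orthonormal.ne_zero k) h1)
      rw [h2]; simp
    have hc1 : c = 1 := by
      apply circle_eq_one_of_pow_eq_one hp Module.finrank_pos.ne' hnp
      · have h1 : ∏ k, χ (τ i k) = ∏ k, c * χ (τ j k) := Finset.prod_congr rfl fun k _ => hck k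
        rw [Finset.prod_mul_distrib, Equiv.prod_comp (τ i) χ, Equiv.prod_comp (τ j) χ] at h1
        simpa using h1
      · have h1 := congrArg (· ^ p) (hck ⟨0, Module.finrank_pos⟩)
        simp only [mul_pow, hd] at h1
        simpa using h1
    funext k
    simpa [hc1] using hck k

/-- The number of pairwise commuting conjugates of an element of prime order modulo scalars is at
least the dimension, and exceeds it if the element is not a complex reflection. -/
lemma hasCommutingConjugates_finrank (hK : ∀ t, t ∈ K ↔ a t ∈ (phase E).range)
    (ha : ∀ v, ∃ t c, a t = phase E c * v) {p : ℕ} (hp : p.Prime) (hnp : Module.finrank ℂ E < p)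
    {x : T} (hxp : x ^ p ∈ K) (hxK : x ∉ K) :
    HasCommutingConjugates K x (Module.finrank ℂ E) ∧
    ((∀ u : E, ‖u‖ = 1 → ∀ c z, a x ≠ phase E c * rot u z) →
      HasCommutingConjugates K x (Module.finrank ℂ E + 1)) := by
  obtain ⟨b, χ, hx⟩ := exists_eq_diagHom (a x)
  have hχ : ∃ i j, χ i ≠ χ j := by
    by_contra! h
    refine hxK ((hK x).2 ?_)
    rcases isEmpty_or_nonempty (Fin (Module.finrank ℂ E)) with h0 | ⟨⟨i₀⟩⟩
    · rw [hx, Subsingleton.elim χ 1, map_one]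
      exact one_mem _
    · refine ⟨χ i₀, ext_basis b fun j => ?_⟩
      rw [hx, phase_apply, diagHom_apply_basis, h i₀ j]
  obtain ⟨i, j, hij⟩ := hχ
  obtain ⟨⟨τ, hτ⟩, hstar⟩ := exists_injective_rearrangements hij
  refine ⟨hasCommutingConjugates_of_injective hK ha hp hnp hxp hx hτ, fun hrot => ?_⟩
  -- A spectrum constant off one index belongs to a scalar times a reflection.
  obtain ⟨τ', hτ'⟩ := hstar fun i => by
    by_contra! h
    obtain ⟨j, hj⟩ : ∃ j, ∀ k, k ≠ i → χ k = χ j := by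
      by_cases hj : ∃ j, j ≠ i
      · obtain ⟨j, hj⟩ := hj
        exact ⟨j, fun k hk => h k j hk hj⟩
      · exact ⟨i, fun k hk => (hj ⟨k, hk⟩).elim⟩
    refine hrot (b i) (b.norm_eq_one i) (χ j) (χ i * (χ j)⁻¹) ?_
    rw [hx]
    refine ext_basis b fun k => ?_
    rw [isometryEquiv_mul_apply, phase_apply, diagHom_apply_basis]
    rcases eq_or_ne k i with rfl | hk
    · rw [rot_apply_self (b.norm_eq_one k), smul_smul, ← Circle.coe_mul, mul_comm (χ k),
        mul_inv_cancel_left]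
    · rw [rot_apply_of_inner_eq_zero (b.norm_eq_one i) (b.orthonormal.2 hk.symm), hj k hk]
  exact hasCommutingConjugates_of_injective hK ha hp hnp hxp hx
    (τ := fun k => τ' (finSuccEquiv _ k)) (hτ'.comp (finSuccEquiv _).injective)

variable {F : Type*} [NormedAddCommGroup F] [InnerProductSpace ℂ F] [FiniteDimensional ℂ F]
  {b : T →* (F ≃ₗᵢ[ℂ] F)}

/-- The count of commuting conjugates depends only on `K`: a reflection on E allows at most dim E,
while its counterpart on F has at least dim F. -/
lemma finrank_le_of_same_kernel (hKa : ∀ t, t ∈ K ↔ a t ∈ (phase E).range)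
    (hKb : ∀ t, t ∈ K ↔ b t ∈ (phase F).range) (ha : ∀ v, ∃ t c, a t = phase E c * v)
    (hb : ∀ v, ∃ t c, b t = phase F c * v) (hn : 2 ≤ Module.finrank ℂ E) :
    Module.finrank ℂ F ≤ Module.finrank ℂ E := by
  obtain ⟨p, hp1, hp⟩ :=
    Nat.exists_infinite_primes (Module.finrank ℂ E + Module.finrank ℂ F + 1)
  obtain ⟨ζ, hζ, hζp⟩ := exists_circle_root hp
  obtain ⟨u, hu⟩ := exists_norm_eq_one_of_two_le hn
  obtain ⟨x, c, hx⟩ := ha (rot u ζ)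
  refine HasCommutingConjugates.le_finrank hKa hp (by omega) hu hζ hζp hx
    (hasCommutingConjugates_finrank hKb hb hp (by omega) ?_ ?_).1
  · rw [hKa, map_pow, hx, phase_mul_rot_pow, hζp, map_one, mul_one]
    exact ⟨_, rfl⟩
  · rw [hKa, hx, phase_mul_mem_range_iff]
    exact fun h => hζ (rot_mem_phase_range hn hu h)

/-- Complex reflections of prime order correspond under an isomorphism of projective unitary
groups. -/
lemma exists_rot_of_same_kernel (hKa : ∀ t, t ∈ K ↔ a t ∈ (phase E).range)
    (hKb : ∀ t, t ∈ K ↔ b t ∈ (phase F).range)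
    (hb : ∀ v, ∃ t c, b t = phase F c * v) (hn : 2 ≤ Module.finrank ℂ E)
    (hEF : Module.finrank ℂ E = Module.finrank ℂ F) {p : ℕ} (hp : p.Prime)
    (hnp : Module.finrank ℂ E < p) {ζ : Circle} (hζ : ζ ≠ 1) (hζp : ζ ^ p = 1) {x : T} {c : Circle}
    {u : E} (hu : ‖u‖ = 1) (hx : a x = phase E c * rot u ζ) :
    ∃ (w : F) (c' ζ' : Circle), ‖w‖ = 1 ∧ ζ' ≠ 1 ∧ ζ' ^ p = 1 ∧ b x = phase F c' * rot w ζ' := by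
  have hxp : x ^ p ∈ K := by
    rw [hKa, map_pow, hx, phase_mul_rot_pow, hζp, map_one, mul_one]
    exact ⟨_, rfl⟩
  have hxK : x ∉ K := by
    rw [hKa, hx, phase_mul_mem_range_iff]
    exact fun h => hζ (rot_mem_phase_range hn hu h)
  obtain ⟨w, hw, c', ζ', h⟩ : ∃ w : F, ‖w‖ = 1 ∧ ∃ c' ζ', b x = phase F c' * rot w ζ' := by
    by_contra! h
    have h1 := (hasCommutingConjugates_finrank hKb hb hp (by omega) hxp hxK).2 h
    have h2 := h1.le_finrank hKa hp hnp hu hζ hζp hx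
    omega
  refine ⟨w, c', ζ', hw, ?_, ?_, h⟩
  · rintro rfl
    rw [hKb, h, map_one, mul_one] at hxK
    exact hxK ⟨_, rfl⟩
  · rw [hKb, map_pow, h, phase_mul_rot_pow, phase_mul_mem_range_iff] at hxp
    exact rot_mem_phase_range (hEF ▸ hn) hw hxp

end Counting

/-! ### Injective endomorphisms of the circle -/

section CircleEndomorphisms

open Filter Topology

lemma continuous_circle_coe : Continuous ((↑) : Circle → ℂ) := continuous_subtype_val

lemma circle_exp_pi : Circle.exp Real.pi = -1 := by
  apply Circle.ext
  rw [Circle.coe_exp, Complex.exp_pi_mul_I]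
  rfl

lemma circle_im_exp (t : ℝ) : (Circle.exp t : ℂ).im = Real.sin t := by
  rw [Circle.coe_exp, Complex.exp_ofReal_mul_I_im]

lemma circle_sq_eq_sq {y z : Circle} (h : y ^ 2 = z ^ 2) : y = z ∨ y = -z := by
  have h1 : (y : ℂ) ^ 2 = (z : ℂ) ^ 2 := by rw [← Circle.coe_pow, h, Circle.coe_pow]
  rcases sq_eq_sq_iff_eq_or_eq_neg.1 h1 with h | h
  · exact Or.inl (Circle.ext h)
  · exact Or.inr (Circle.ext h)

lemma circle_eq_one_or_of_im_eq_zero {z : Circle} (h : (z : ℂ).im = 0) : z = 1 ∨ z = -1 := by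
  apply circle_sq_eq_sq
  have h1 := Circle.normSq_coe z
  rw [Complex.normSq_apply, h, mul_zero, add_zero] at h1
  apply Circle.ext
  rw [Circle.coe_pow, sq]
  apply Complex.ext
  · simp [h, h1]
  · simp [h]

lemma map_neg_one_of_injective {σ : Circle →* Circle} (hσ : Function.Injective σ) :
    σ (-1) = -1 := by
  have h1 : σ (-1) ^ 2 = 1 ^ 2 := by rw [← map_pow]; simp
  refine (circle_sq_eq_sq h1).resolve_left fun h => ?_
  have h2 : (-1 : Circle) = 1 := hσ (h.trans (map_one σ).symm)
  have h3 := congrArg (fun z : Circle => (z : ℂ).re) h2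
  have h4 : ((-1 : Circle) : ℂ) = -1 := rfl
  simp only [h4, Circle.coe_one, Complex.neg_re, Complex.one_re] at h3
  linarith

/-- Halving angles from π, the square is known at each stage and positivity of the imaginary part
selects the root. Dyadic multiples of π are dense, and continuity does the rest. -/
lemma eq_self_of_im_pos {σ : Circle →* Circle} (hσ : Function.Injective σ) (hc : Continuous σ)
    (hpos : ∀ t ∈ Set.Ioo 0 Real.pi, 0 < (σ (Circle.exp t) : ℂ).im) (z : Circle) : σ z = z := by
  have hdyadic (k : ℕ) : σ (Circle.exp (Real.pi / 2 ^ k)) = Circle.exp (Real.pi / 2 ^ k) := by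
    induction k with
    | zero => rw [pow_zero, div_one, circle_exp_pi, map_neg_one_of_injective hσ]
    | succ k ih =>
      have hmem : Real.pi / 2 ^ (k + 1) ∈ Set.Ioo 0 Real.pi := by
        refine ⟨by positivity, div_lt_self Real.pi_pos (one_lt_pow₀ one_lt_two (by omega))⟩
      have hsq : Circle.exp (Real.pi / 2 ^ (k + 1)) ^ 2 = Circle.exp (Real.pi / 2 ^ k) := by
        rw [← Circle.exp_nsmul]; congr 1; rw [pow_succ]; simp; field_simp
      have h1 : σ (Circle.exp (Real.pi / 2 ^ (k + 1))) ^ 2 =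
          Circle.exp (Real.pi / 2 ^ (k + 1)) ^ 2 := by rw [← map_pow, hsq, ih]
      refine (circle_sq_eq_sq h1).resolve_right fun h => ?_
      have h2 := hpos _ hmem
      have h3 : ((-Circle.exp (Real.pi / 2 ^ (k + 1)) : Circle) : ℂ).im =
          -(Circle.exp (Real.pi / 2 ^ (k + 1)) : ℂ).im := rfl
      rw [h, h3, circle_im_exp] at h2
      linarith [Real.sin_pos_of_pos_of_lt_pi hmem.1 hmem.2]
  obtain ⟨t, rfl⟩ := Circle.exp_surjective z
  let s : ℕ → ℝ := fun k => (⌊t * 2 ^ k / Real.pi⌋ : ℝ) * (Real.pi / 2 ^ k)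
  have hs : Tendsto s atTop (𝓝 t) := by
    have h0 : Tendsto (fun k : ℕ => Real.pi / 2 ^ k) atTop (𝓝 0) := by
      have := tendsto_const_nhds (x := Real.pi).mul
        (tendsto_pow_atTop_nhds_zero_of_lt_one (r := (1 / 2 : ℝ)) (by norm_num) (by norm_num))
      simpa [div_eq_mul_inv] using this
    rw [tendsto_iff_dist_tendsto_zero]
    refine squeeze_zero (fun _ => dist_nonneg) (fun k => ?_) h0
    have h1 := Int.floor_le (t * 2 ^ k / Real.pi)
    have h2 := Int.lt_floor_add_one (t * 2 ^ k / Real.pi)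
    have hq : 0 < Real.pi / 2 ^ k := by positivity
    have h3 : t = t * 2 ^ k / Real.pi * (Real.pi / 2 ^ k) := by
      have := Real.pi_ne_zero
      field_simp
    rw [Real.dist_eq, abs_le]
    constructor <;> simp only [s] <;> nlinarith
  have hsσ (k : ℕ) : σ (Circle.exp (s k)) = Circle.exp (s k) := by
    have : Circle.exp (s k) = Circle.exp (Real.pi / 2 ^ k) ^ ⌊t * 2 ^ k / Real.pi⌋ := by
      rw [← Circle.exp_zsmul, zsmul_eq_mul]
    rw [this, map_zpow, hdyadic]
  have hexp : Tendsto (fun k => Circle.exp (s k)) atTop (𝓝 (Circle.exp t)) :=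
    (Circle.exp.continuous.tendsto t).comp hs
  have h1 : Tendsto (fun k => σ (Circle.exp (s k))) atTop (𝓝 (σ (Circle.exp t))) :=
    (hc.tendsto _).comp hexp
  simp only [hsσ] at h1
  exact tendsto_nhds_unique h1 hexp

/-- Continuous injective endomorphisms of the circle are trivial or the inversion. -/
theorem circle_endomorphism_classification {σ : Circle →* Circle} (hσ : Function.Injective σ)
    (hc : Continuous σ) : (∀ z, σ z = z) ∨ ∀ z, σ z = z⁻¹ := by
  set f : ℝ → ℝ := fun t => (σ (Circle.exp t) : ℂ).im with hf
  have hfc : Continuous f := by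
    have := hc.comp Circle.exp.continuous
    exact Complex.continuous_im.comp (continuous_circle_coe.comp this)
  -- Imaginary part zero means the value ±1, which injectivity reserves for ±1; hence the sign is
  -- constant on the open upper half circle.
  have hne : ∀ t ∈ Set.Ioo 0 Real.pi, f t ≠ 0 := by
    intro t ht h
    have h1 : Circle.exp t = 1 ∨ Circle.exp t = -1 := by
      rcases circle_eq_one_or_of_im_eq_zero h with h | h
      · exact Or.inl (hσ (h.trans (map_one σ).symm))
      · exact Or.inr (hσ (h.trans (map_neg_one_of_injective hσ).symm))
    have h2 := circle_im_exp t
    have h3 : ((-1 : Circle) : ℂ).im = 0 := by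
      rw [show ((-1 : Circle) : ℂ) = -1 from rfl]; simp
    have h4 := Real.sin_pos_of_pos_of_lt_pi ht.1 ht.2
    rcases h1 with h1 | h1 <;> rw [h1] at h2
    · simp at h2; linarith
    · rw [h3] at h2; linarith
  have hpre : IsPreconnected (f '' Set.Ioo 0 Real.pi) :=
    isPreconnected_Ioo.image f hfc.continuousOn
  by_cases hp : ∀ t ∈ Set.Ioo 0 Real.pi, 0 < f t
  · exact Or.inl (eq_self_of_im_pos hσ hc hp)
  · right
    push Not at hp
    obtain ⟨t₀, ht₀, hft₀⟩ := hp
    have hneg : ∀ t ∈ Set.Ioo 0 Real.pi, f t < 0 := by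
      intro t ht
      by_contra h
      push Not at h
      obtain ⟨t', ht', h0⟩ := hpre.ordConnected.out ⟨t₀, ht₀, rfl⟩ ⟨t, ht, rfl⟩ ⟨hft₀, h⟩
      exact hne t' ht' h0
    let τ : Circle →* Circle := (invMonoidHom : Circle →* Circle).comp σ
    have hτ (z) : τ z = z := by
      refine eq_self_of_im_pos (inv_injective.comp hσ) hc.inv (fun t ht => ?_) z
      change 0 < (((σ (Circle.exp t))⁻¹ : Circle) : ℂ).im
      rw [Circle.coe_inv_eq_conj, Complex.conj_im]
      exact neg_pos.2 (hneg t ht)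
    intro z
    exact inv_eq_iff_eq_inv.1 (hτ z)

lemma circle_norm_sub_one_sq (z : Circle) : ‖(z : ℂ) - 1‖ ^ 2 = 2 * (1 - (z : ℂ).re) := by
  have h1 := Circle.normSq_coe z
  rw [Complex.normSq_apply] at h1
  rw [← Complex.normSq_eq_norm_sq, Complex.normSq_apply]
  simp only [Complex.sub_re, Complex.one_re, Complex.sub_im, Complex.one_im]
  nlinarith

lemma circle_re_sq (z : Circle) : ((z ^ 2 : Circle) : ℂ).re = 2 * (z : ℂ).re ^ 2 - 1 := by
  have h1 := Circle.normSq_coe z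
  rw [Complex.normSq_apply] at h1
  rw [Circle.coe_pow, sq, Complex.mul_re]
  nlinarith

/-- No continuity is involved: an injective endomorphism permutes the N-th roots of unity, so for
large N a root near 1 is the image of some nontrivial root. -/
lemma exists_re_map_close {σ : Circle →* Circle} (hσ : Function.Injective σ) {ε : ℝ} (hε : 0 < ε) :
    ∃ z : Circle, z ≠ 1 ∧ 1 - ε ≤ (σ z : ℂ).re := by
  obtain ⟨N, hN⟩ := exists_nat_gt ((2 * Real.pi) ^ 2 / ε + 1)
  have hN1 : (1 : ℝ) < N := by
    have : 0 ≤ (2 * Real.pi) ^ 2 / ε := by positivity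
    linarith
  have hN0 : N ≠ 0 := by rintro rfl; norm_num at hN1
  have hN0' : (N : ℝ) ≠ 0 := by exact_mod_cast hN0
  let η : Circle := Circle.exp (2 * Real.pi / N)
  have hηc : (η : ℂ) = Complex.exp (2 * Real.pi * Complex.I / N) := by
    rw [Circle.coe_exp]; congr 1; push_cast; ring
  have hη : IsPrimitiveRoot (η : ℂ) N := by
    rw [hηc]; exact Complex.isPrimitiveRoot_exp N hN0
  have hη' : IsPrimitiveRoot η N := by
    refine IsPrimitiveRoot.of_map_of_injective (f := Circle.coeHom) ?_ Circle.coe_injective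
    exact hη
  have hση : IsPrimitiveRoot (Circle.coeHom (σ η)) N :=
    (hη'.map_of_injective hσ).map_of_injective (f := Circle.coeHom) Circle.coe_injective
  have : NeZero N := ⟨hN0⟩
  obtain ⟨i, -, hi⟩ := hση.eq_pow_of_pow_eq_one hη.pow_eq_one
  have hi' : σ (η ^ i) = η := by
    apply Circle.ext
    rw [map_pow, Circle.coe_pow]
    exact hi
  refine ⟨η ^ i, fun h => ?_, ?_⟩
  · rw [h, map_one] at hi'
    rw [← hi'] at hη'
    have := hη'.unique IsPrimitiveRoot.one
    rw [this] at hN1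
    norm_num at hN1
  · rw [hi']
    simp only [η]
    rw [Circle.coe_exp, Complex.exp_ofReal_mul_I_re]
    refine le_trans ?_ (Real.one_sub_sq_div_two_le_cos)
    have h1 : (2 * Real.pi) ^ 2 < ε * N := by
      have : (2 * Real.pi) ^ 2 / ε < N := by linarith
      rw [div_lt_iff₀ hε] at this
      linarith
    have h2 : (2 * Real.pi / N) ^ 2 ≤ ε := by
      rw [div_pow, div_le_iff₀ (by positivity)]
      nlinarith
    linarith

/-- An injective endomorphism of the circle is continuous if it maps small arcs into small arcs, up
to doubling angles. -/
lemma continuous_of_re_map_sq {σ : Circle →* Circle} (hσ : Function.Injective σ)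
    (h : ∀ z v : Circle, (z : ℂ).re ≤ (v : ℂ).re →
      1 - 4 * (1 - (σ z : ℂ).re) ≤ (σ (v ^ 2) : ℂ).re) : Continuous σ := by
  apply continuous_of_continuousAt_one
  rw [ContinuousAt, map_one, Metric.tendsto_nhds]
  intro ε hε
  -- With this tolerance 1 - Re (σ w) ≤ ε² / 4, so |σ w - 1|² = 2 (1 - Re (σ w)) ≤ ε² / 2.
  obtain ⟨z, hz1, hz⟩ := exists_re_map_close hσ (ε := ε ^ 2 / 16) (by positivity)
  have hzre : (z : ℂ).re < 1 := by
    refine lt_of_le_of_ne (circle_re_le_one z) fun h => hz1 ?_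
    have h1 := circle_norm_sub_one_sq z
    rw [h, sub_self, mul_zero, sq_eq_zero_iff, norm_eq_zero, sub_eq_zero] at h1
    exact Circle.coe_eq_one.1 h1
  set r := max (z : ℂ).re 0 with hr
  have hr0 : 0 ≤ r := le_max_right _ _
  have hr1 : r < 1 := max_lt hzre one_pos
  have hcont : Continuous fun w : Circle => (w : ℂ).re :=
    Complex.continuous_re.comp continuous_circle_coe
  -- By the double angle formula, this neighbourhood consists of squares v² with Re v ≥ r, where v
  -- is the root with nonnegative real part.
  have hev : ∀ᶠ w : Circle in 𝓝 1, 2 * r ^ 2 - 1 < (w : ℂ).re := by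
    refine hcont.continuousAt.eventually (lt_mem_nhds ?_)
    have h1 : ((1 : Circle) : ℂ).re = 1 := by rw [Circle.coe_one, Complex.one_re]
    simp only [h1]
    nlinarith
  filter_upwards [hev] with w hw
  obtain ⟨v, hv, hv0⟩ : ∃ v : Circle, v ^ 2 = w ∧ 0 ≤ (v : ℂ).re := by
    obtain ⟨v, hv⟩ := exists_circle_pow_eq w two_ne_zero
    rcases le_total 0 (v : ℂ).re with h0 | h0
    · exact ⟨v, hv, h0⟩
    · refine ⟨-v, by rw [neg_sq, hv], ?_⟩
      change 0 ≤ (-(v : ℂ)).re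
      rw [Complex.neg_re]
      linarith
  have hvr : r ≤ (v : ℂ).re := by
    rw [← hv, circle_re_sq] at hw
    exact (abs_le_of_sq_le_sq' (by linarith) hv0).2
  have h1 := h z v ((le_max_left _ _).trans hvr)
  rw [hv] at h1
  have h2 := circle_norm_sub_one_sq (σ w)
  have h3 : ‖(σ w : ℂ) - 1‖ < ε := by
    refine lt_of_pow_lt_pow_left₀ 2 hε.le ?_
    rw [h2]
    nlinarith
  have h4 : dist (σ w) 1 = dist (σ w : ℂ) 1 := rfl
  rw [h4, dist_eq_norm]
  exact h3

end CircleEndomorphisms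

/-! ### Abstract isomorphisms of projective unitary groups preserve |Tr| -/

section Rigidity

variable {E : Type*} [NormedAddCommGroup E] [InnerProductSpace ℂ E] [FiniteDimensional ℂ E]
variable {F : Type*} [NormedAddCommGroup F] [InnerProductSpace ℂ F] [FiniteDimensional ℂ F]
variable {T : Type*} [Group T] {K : Subgroup T} {a : T →* (E ≃ₗᵢ[ℂ] E)} {b : T →* (F ≃ₗᵢ[ℂ] F)}

lemma phase_mul_mul_inv_mem_range_iff (c d : Circle) (v w : E ≃ₗᵢ[ℂ] E) :
    (phase E c * v) * (phase E d * w)⁻¹ ∈ (phase E).range ↔ v * w⁻¹ ∈ (phase E).range := by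
  have h : (phase E c * v) * (phase E d * w)⁻¹ = phase E (c * d⁻¹) * (v * w⁻¹) := by
    rw [mul_inv_rev, ← map_inv, mul_assoc, ← mul_assoc v, ← phase_comm d⁻¹ (v * w⁻¹), map_mul,
      mul_assoc]
  rw [h, phase_mul_mem_range_iff]

lemma exists_eq_phase_mul_of_mul_inv_mem {v w : E ≃ₗᵢ[ℂ] E} (h : v * w⁻¹ ∈ (phase E).range) :
    ∃ c, v = phase E c * w := by
  obtain ⟨c, hc⟩ := h
  exact ⟨c, by rw [hc, inv_mul_cancel_right]⟩

lemma mul_inv_phase_mul_mem (c : Circle) (w : E ≃ₗᵢ[ℂ] E) :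
    (phase E c * w) * w⁻¹ ∈ (phase E).range := by
  rw [mul_inv_cancel_right]; exact ⟨c, rfl⟩

lemma rot_mul_inv_mem_phase_range_iff (hn : 2 ≤ Module.finrank ℂ E) {u : E} (hu : ‖u‖ = 1)
    {y z : Circle} : rot u y * (rot u z)⁻¹ ∈ (phase E).range ↔ y = z := by
  constructor
  · intro h
    rw [← map_inv, ← map_mul] at h
    exact mul_inv_eq_one.1 (rot_mem_phase_range hn hu h)
  · rintro rfl
    rw [mul_inv_cancel]
    exact one_mem _

lemma eq_smul_of_rot_mul_inv_mem {p : ℕ} (hp : p.Prime) (hnp : Module.finrank ℂ E < p) {u w : E}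
    (hu : ‖u‖ = 1) (hw : ‖w‖ = 1) {ζ : Circle} (hζ : ζ ≠ 1) (hζp : ζ ^ p = 1)
    (h : rot u ζ * (rot w ζ)⁻¹ ∈ (phase E).range) : ∃ c : ℂ, w = c • u := by
  have : Nontrivial E := ⟨u, 0, fun h => by simp [h] at hu⟩
  obtain ⟨c, hc⟩ := h
  suffices hc1 : c = 1 by
    rw [hc1, map_one, eq_comm, mul_inv_eq_one] at hc
    exact eq_smul_of_rot_eq_rot hu hw hζ hc
  apply circle_eq_one_of_pow_eq_one hp Module.finrank_pos.ne' hnp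
  · apply circle_pow_finrank_eq_one_of_det
    rw [hc, ← map_inv]
    exact rotPair_mem_specialUnitary hu hw ζ
  · have h1 : rot u ζ = phase E c * rot w ζ := by rw [hc, inv_mul_cancel_right]
    have h2 := congrArg (· ^ p) h1
    simp only [phase_mul_rot_pow, rot_pow_eq_one _ hζp, hζp, map_one, mul_one] at h2
    exact phase_injective (h2.symm.trans (map_one _).symm)

/-- An abstract isomorphism between projective unitary groups maps complex reflections to complex
reflections, through an endomorphism of the circle and a map preserving orthogonality. -/
theorem exists_circle_endomorphism (hKa : ∀ t, t ∈ K ↔ a t ∈ (phase E).range)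
    (hKb : ∀ t, t ∈ K ↔ b t ∈ (phase F).range)
    (ha : ∀ v, ∃ t c, a t = phase E c * v) (hb : ∀ v, ∃ t c, b t = phase F c * v)
    (hn : 2 ≤ Module.finrank ℂ E) (hEF : Module.finrank ℂ E = Module.finrank ℂ F) :
    ∃ (σ : Circle →* Circle) (φ : E → F), Function.Injective σ ∧ (∀ u, ‖u‖ = 1 → ‖φ u‖ = 1) ∧
      (∀ u v, ‖u‖ = 1 → ‖v‖ = 1 → ⟪u, v⟫_ℂ = 0 → ⟪φ u, φ v⟫_ℂ = 0) ∧
      ∀ u, ‖u‖ = 1 → ∀ x c z, a x = phase E c * rot u z →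
        ∃ c', b x = phase F c' * rot (φ u) (σ z) := by
  obtain ⟨p, hp1, hp⟩ := Nat.exists_infinite_primes (Module.finrank ℂ E + 1)
  have hnE : Module.finrank ℂ E < p := by omega
  have hnF : Module.finrank ℂ F < p := by omega
  obtain ⟨ζ, hζ, hζp⟩ := exists_circle_root hp
  obtain ⟨u₀, hu₀⟩ := exists_norm_eq_one_of_two_le hn
  obtain ⟨x₀, c₀, hx₀⟩ := ha (rot u₀ ζ)
  obtain ⟨w₀, c₀', ζ', hw₀, hζ', hζp', hx₀'⟩ :=
    exists_rot_of_same_kernel hKa hKb hb hn hEF hp hnE hζ hζp hu₀ hx₀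
  -- The correspondence of lines: one element of `T` acts modulo scalars as the order-p reflection
  -- in `u` and in `w`, with angles `ζ` and `ζ'` fixed once for all. It is stable under conjugation
  -- by `T`.
  let Rel : E → F → Prop := fun u w =>
    ∃ x c c', a x = phase E c * rot u ζ ∧ b x = phase F c' * rot w ζ'
  have hrel_conj (t : T) {u : E} {w : F} (hu : ‖u‖ = 1) (hw : ‖w‖ = 1) (h : Rel u w) :
      Rel (a t u) (b t w) := by
    obtain ⟨x, c, c', h1, h2⟩ := h
    exact ⟨t * x * t⁻¹, c, c', map_conj_eq hu h1, map_conj_eq hw h2⟩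
  have hrel₀ : Rel u₀ w₀ := ⟨x₀, c₀, c₀', hx₀, hx₀'⟩
  have hsurj_right (w : F) (hw : ‖w‖ = 1) : ∃ u, ‖u‖ = 1 ∧ Rel u w := by
    obtain ⟨g, hg⟩ := exists_map_unit hw₀ hw
    obtain ⟨t, d, ht⟩ := hb g
    have h1 := hrel_conj t hu₀ hw₀ hrel₀
    rw [ht, isometryEquiv_mul_apply, phase_apply, hg] at h1
    obtain ⟨x, c, c', h2, h3⟩ := h1
    rw [rot_smul (Circle.coe_ne_zero d)] at h3
    exact ⟨a t u₀, by rw [LinearIsometryEquiv.norm_map, hu₀], x, c, c', h2, h3⟩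
  have hsurj_left (u : E) (hu : ‖u‖ = 1) : ∃ t, ∀ z, rot (a t u₀) z = rot u z := by
    obtain ⟨g, hg⟩ := exists_map_unit hu₀ hu
    obtain ⟨t, d, ht⟩ := ha g
    refine ⟨t, fun z => ?_⟩
    rw [ht, isometryEquiv_mul_apply, phase_apply, hg, rot_smul (Circle.coe_ne_zero d)]
  have hcommutator {x y : T} {u u' : E} {w w' : F} {c d c' d' z z' y₁ y₂ : Circle}
      (h1 : a x = phase E c * rot u z) (h2 : b x = phase F c' * rot w y₁)
      (h3 : a y = phase E d * rot u' z') (h4 : b y = phase F d' * rot w' y₂) :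
      ⁅rot u z, rot u' z'⁆ ∈ (phase E).range ↔ ⁅rot w y₁, rot w' y₂⁆ ∈ (phase F).range := by
    rw [← commutator_phase_mul_left _ _ c, ← commutator_phase_mul _ _ d, ← h1, ← h3,
      ← commutator_phase_mul_left (rot w y₁) _ c', ← commutator_phase_mul _ (rot w' y₂) d', ← h2,
      ← h4, ← map_commutatorElement, ← map_commutatorElement, ← hKa, hKb]
  have hquot {x y : T} {v v' : E ≃ₗᵢ[ℂ] E} {r r' : F ≃ₗᵢ[ℂ] F} {c d c' d' : Circle}
      (h1 : a x = phase E c * v) (h2 : b x = phase F c' * r)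
      (h3 : a y = phase E d * v') (h4 : b y = phase F d' * r') :
      v * v'⁻¹ ∈ (phase E).range ↔ r * r'⁻¹ ∈ (phase F).range := by
    rw [← phase_mul_mul_inv_mem_range_iff c d v, ← phase_mul_mul_inv_mem_range_iff c' d' r, ← h1, ← h3,
      ← h2, ← h4, ← map_inv, ← map_mul, ← map_inv, ← map_mul, ← hKa, hKb]
  -- Orthogonal lines are those whose reflections commute without coinciding, and both properties
  -- are visible modulo `K`.
  have hrel_orth {u u' : E} {w w' : F} (hu : ‖u‖ = 1) (hu' : ‖u'‖ = 1) (hw : ‖w‖ = 1)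
      (hw' : ‖w'‖ = 1) (h : Rel u w) (h' : Rel u' w') : ⟪u, u'⟫_ℂ = 0 ↔ ⟪w, w'⟫_ℂ = 0 := by
    obtain ⟨x, c, c', h1, h2⟩ := h
    obtain ⟨x', d, d', h3, h4⟩ := h'
    constructor
    · intro hor
      have h5 : ⁅rot w ζ', rot w' ζ'⁆ ∈ (phase F).range := by
        rw [← hcommutator h1 h2 h3 h4,
          commutatorElement_eq_one_iff_commute.2 (rot_commute hu hu' hor _ _)]
        exact one_mem _
      have h6 := commute_of_commutator_mem hp hnF
        (by rw [rot_pow_eq_one _ hζp']; exact one_mem _) h5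
      refine (inner_eq_zero_or_parallel hw hw' hζ' hζ' h6).resolve_right ?_
      rintro ⟨r, hr, hr'⟩
      have h7 : rot w ζ' * (rot w' ζ')⁻¹ ∈ (phase F).range := by
        rw [hr', rot_smul hr, mul_inv_cancel]; exact one_mem _
      rw [← hquot h1 h2 h3 h4] at h7
      obtain ⟨s, hs⟩ := eq_smul_of_rot_mul_inv_mem hp hnE hu hu' hζ hζp h7
      rw [hs, inner_smul_right, inner_self_eq_norm_sq_to_K, hu] at hor
      have hs0 : s = 0 := by simpa using hor
      rw [hs, hs0, zero_smul, norm_zero] at hu'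
      exact zero_ne_one hu'
    · intro hor
      have h5 : ⁅rot u ζ, rot u' ζ⁆ ∈ (phase E).range := by
        rw [hcommutator h1 h2 h3 h4,
          commutatorElement_eq_one_iff_commute.2 (rot_commute hw hw' hor _ _)]
        exact one_mem _
      have h6 := commute_of_commutator_mem hp hnE
        (by rw [rot_pow_eq_one _ hζp]; exact one_mem _) h5
      refine (inner_eq_zero_or_parallel hu hu' hζ hζ h6).resolve_right ?_
      rintro ⟨r, hr, hr'⟩
      have h7 : rot u ζ * (rot u' ζ)⁻¹ ∈ (phase E).range := by
        rw [hr', rot_smul hr, mul_inv_cancel]; exact one_mem _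
      rw [hquot h1 h2 h3 h4] at h7
      obtain ⟨s, hs⟩ := eq_smul_of_rot_mul_inv_mem hp hnF hw hw' hζ' hζp' h7
      rw [hs, inner_smul_right, inner_self_eq_norm_sq_to_K, hw] at hor
      have hs0 : s = 0 := by simpa using hor
      rw [hs, hs0, zero_smul, norm_zero] at hw'
      exact zero_ne_one hw'
  -- An element over `rot u₀ z` commutes modulo `K` with the order-p reflections in `u₀` and in all
  -- lines orthogonal to it. So on F it has `w₀` and every unit vector orthogonal to `w₀` as
  -- eigenvectors, and is a scalar times a reflection.
  have hgraph (z : Circle) : ∃ y : Circle, ∃ x c c', a x = phase E c * rot u₀ z ∧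
      b x = phase F c' * rot w₀ y := by
    obtain ⟨x, c, hx⟩ := ha (rot u₀ z)
    have heig {u : E} {w : F} (hw : ‖w‖ = 1) (h : Rel u w) (hcomm : Commute (rot u₀ z) (rot u ζ)) :
        ∃ r : ℂ, b x w = r • w := by
      obtain ⟨x', d, d', h3, h4⟩ := h
      refine exists_apply_eq_smul_of_commutator_mem hp hnF hw hζ' hζp' ?_
      rw [← commutator_phase_mul _ _ d', ← h4, ← map_commutatorElement, ← hKb, hKa,
        map_commutatorElement, hx, h3, commutator_phase_mul, commutator_phase_mul_left,
        commutatorElement_eq_one_iff_commute.2 hcomm]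
      exact one_mem _
    obtain ⟨c', y, h⟩ := exists_eq_phase_mul_rot (X := b x) hw₀
      (heig hw₀ hrel₀ (by rw [Commute, SemiconjBy, ← map_mul, ← map_mul, mul_comm]))
      fun w hw hor => by
        obtain ⟨u, hu, hr⟩ := hsurj_right w hw
        exact heig hw hr (rot_commute hu₀ hu ((hrel_orth hu₀ hu hw₀ hw hrel₀ hr).2 hor) _ _)
    exact ⟨y, x, c, c', hx, h⟩
  choose σ X C C' hX hX' using hgraph
  have hnF2 : 2 ≤ Module.finrank ℂ F := hEF ▸ hn
  have hmul (y z : Circle) : σ (y * z) = σ y * σ z := by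
    have h1 : a (X y * X z) = phase E (C y * C z) * rot u₀ (y * z) := by
      rw [map_mul, hX, hX, map_mul, map_mul, mul_assoc, ← mul_assoc (rot u₀ y), ← phase_comm]
      simp only [mul_assoc]
    have h2 : b (X y * X z) = phase F (C' y * C' z) * rot w₀ (σ y * σ z) := by
      rw [map_mul, hX', hX', map_mul, map_mul, mul_assoc, ← mul_assoc (rot w₀ _), ← phase_comm]
      simp only [mul_assoc]
    exact (rot_mul_inv_mem_phase_range_iff hnF2 hw₀).1 ((hquot (hX _) (hX' _) h1 h2).1 ((rot_mul_inv_mem_phase_range_iff hn hu₀).2 rfl))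
  let σ' : Circle →* Circle := MonoidHom.mk' σ hmul
  -- The value at `u` is transported from `w₀` by an element of `T` carrying `u₀` to the line of
  -- `u`; conjugation shows that `σ` is the same for every line.
  have hφ (u : E) : ∃ w : F, ‖u‖ = 1 → ‖w‖ = 1 ∧ Rel u w ∧ ∀ x c z, a x = phase E c * rot u z →
      ∃ c', b x = phase F c' * rot w (σ z) := by
    by_cases hu : ‖u‖ = 1
    · obtain ⟨t, ht⟩ := hsurj_left u hu
      refine ⟨b t w₀, fun _ => ⟨by rw [LinearIsometryEquiv.norm_map, hw₀], ?_, fun x c z hx => ?_⟩⟩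
      · obtain ⟨x, c, c', h1, h2⟩ := hrel_conj t hu₀ hw₀ hrel₀
        exact ⟨x, c, c', by rw [h1, ht], h2⟩
      · have h1 : a (t * X z * t⁻¹) = phase E (C z) * rot u z := by
          rw [map_conj_eq hu₀ (hX z), ht]
        have h2 := map_conj_eq (g := t) hw₀ (hX' z)
        have h3 : b x = phase F 1 * b x := by rw [map_one, one_mul]
        refine exists_eq_phase_mul_of_mul_inv_mem ((hquot hx h3 h1 h2).1 ?_)
        rw [mul_inv_cancel]; exact one_mem _
    · exact ⟨0, fun h => (hu h).elim⟩
  choose φ hφ using hφ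
  refine ⟨σ', φ, fun y z hyz => ?_, fun u hu => (hφ u hu).1, fun u v hu hv huv => ?_,
    fun u hu => (hφ u hu).2.2⟩
  · exact (rot_mul_inv_mem_phase_range_iff hn hu₀).1 ((hquot (hX y) (hX' y) (hX z) (hX' z)).2 ((rot_mul_inv_mem_phase_range_iff hnF2 hw₀).2 hyz))
  · exact (hrel_orth hu hv (hφ u hu).1 (hφ v hv).1 (hφ u hu).2.1 (hφ v hv).2.1).1 huv

/-- Tilting the second line from orthogonal to equal moves the angle of the product continuously
from `z` to 1; the squared overlap s solves (1 - Re z) (1 - s) = 1 - Re v. -/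
lemma exists_rotPair_eq_of_re_le (hn : 2 ≤ Module.finrank ℂ E) {z v : Circle}
    (hzv : (z : ℂ).re ≤ (v : ℂ).re) : ∃ a c u w : E, ‖a‖ = 1 ∧ ‖c‖ = 1 ∧ ‖u‖ = 1 ∧ ‖w‖ = 1 ∧
      ⟪u, w⟫_ℂ = 0 ∧ rotPair a c z = rotPair u w v := by
  obtain ⟨e, he⟩ := exists_norm_eq_one_of_two_le hn
  obtain ⟨f, hf, hef⟩ := exists_unit_inner_eq_zero hn he
  obtain ⟨s, hs0, hs1, hs⟩ : ∃ s : ℝ, 0 ≤ s ∧ s ≤ 1 ∧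
      (1 - (z : ℂ).re) * (1 - s) = 1 - (v : ℂ).re := by
    have hv := circle_re_le_one v
    rcases (circle_re_le_one z).eq_or_lt with h | h
    · exact ⟨0, le_rfl, zero_le_one, by rw [h] at hzv ⊢; linarith⟩
    · have h' : 0 < 1 - (z : ℂ).re := by linarith
      refine ⟨1 - (1 - (v : ℂ).re) / (1 - (z : ℂ).re), ?_, ?_, ?_⟩
      · rw [sub_nonneg, div_le_one h']; linarith
      · rw [sub_le_self_iff]; exact div_nonneg (by linarith) h'.le
      · field_simp; ring
  set c : E := ((Real.sqrt s : ℝ) : ℂ) • e + ((Real.sqrt (1 - s) : ℝ) : ℂ) • f with hc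
  have hee : ⟪e, e⟫_ℂ = 1 := by rw [inner_self_eq_norm_sq_to_K, he]; simp
  have hec : ⟪e, c⟫_ℂ = ((Real.sqrt s : ℝ) : ℂ) := by
    rw [hc, inner_add_right, inner_smul_right, inner_smul_right, hee, hef]; ring
  have hcn : ‖c‖ = 1 := by
    have h1 : ‖c‖ ^ 2 = 1 := by
      rw [hc, sq, norm_add_sq_eq_norm_sq_add_norm_sq_of_inner_eq_zero (𝕜 := ℂ)]
      · rw [norm_smul, norm_smul, he, hf, Complex.norm_real, Complex.norm_real, Real.norm_eq_abs,
          Real.norm_eq_abs, mul_one, mul_one, abs_mul_abs_self, abs_mul_abs_self,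
          Real.mul_self_sqrt hs0, Real.mul_self_sqrt (by linarith)]
        ring
      · rw [inner_smul_left, inner_smul_right, hef]; ring
    exact (pow_eq_one_iff_of_nonneg (norm_nonneg c) two_ne_zero).1 h1
  obtain ⟨u, w, v', hu, hw, huw, heq, hre⟩ := exists_rotPair_eq hn he hcn z
  rw [hec, Complex.norm_real, Real.norm_eq_abs, sq_abs, Real.sq_sqrt hs0, hs] at hre
  rcases circle_eq_or_eq_inv_of_re_eq (show (v' : ℂ).re = (v : ℂ).re by linarith) with rfl | rfl
  · exact ⟨e, c, u, w, he, hcn, hu, hw, huw, heq⟩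
  · refine ⟨e, c, w, u, he, hcn, hw, hu, inner_eq_zero_symm.1 huw, ?_⟩
    rw [heq, rotPair_inv_right hu hw huw]

lemma phase_mul_rot_mul_inv (c d z : Circle) (u w : E) :
    (phase E c * rot u z) * (phase E d * rot w z)⁻¹ = phase E (c * d⁻¹) * rotPair u w z := by
  rw [mul_inv_rev, ← map_inv, ← map_inv, mul_assoc, ← mul_assoc (rot u z), ← phase_comm d⁻¹ _,
    map_mul, mul_assoc, rotPair]

/-- An abstract isomorphism between projective unitary groups preserves dimensions and the absolute
value of the trace. -/
theorem norm_unitaryTrace_eq_of_same_kernel (hKa : ∀ t, t ∈ K ↔ a t ∈ (phase E).range)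
    (hKb : ∀ t, t ∈ K ↔ b t ∈ (phase F).range)
    (ha : ∀ v, ∃ t c, a t = phase E c * v) (hb : ∀ v, ∃ t c, b t = phase F c * v)
    (hn : 2 ≤ Module.finrank ℂ E) (hn' : 2 ≤ Module.finrank ℂ F) :
    Module.finrank ℂ E = Module.finrank ℂ F ∧ ∀ t, ‖unitaryTrace (a t)‖ = ‖unitaryTrace (b t)‖ := by
  have hEF : Module.finrank ℂ E = Module.finrank ℂ F :=
    le_antisymm (finrank_le_of_same_kernel hKb hKa hb ha hn')
      (finrank_le_of_same_kernel hKa hKb ha hb hn)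
  obtain ⟨σ, φ, hσ, hφ, hφo, hrot⟩ := exists_circle_endomorphism hKa hKb ha hb hn hEF
  refine ⟨hEF, ?_⟩
  have htrans {x y : T} (h : ∃ c, a x = phase E c * a y) : ∃ c, b x = phase F c * b y := by
    obtain ⟨c, hc⟩ := h
    apply exists_eq_phase_mul_of_mul_inv_mem
    rw [← map_inv, ← map_mul, ← hKb, hKa, map_mul, map_inv, hc]
    exact mul_inv_phase_mul_mem c _
  -- The element of PU(E) written with angle `z` on tilted lines and with angle `v` on orthogonal
  -- ones has two images in PU(F) with equal |Tr|. This bounds Re (σ v) below only up to the sign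
  -- lost in the absolute value; squaring `v` removes the sign.
  have hcont : Continuous σ := by
    refine continuous_of_re_map_sq hσ fun z v hzv => ?_
    obtain ⟨e, f, u, w, he, hf, hu, hw, huw, heq⟩ := exists_rotPair_eq_of_re_le hn hzv
    obtain ⟨x₁, c₁, h₁⟩ := ha (rot e z)
    obtain ⟨x₂, c₂, h₂⟩ := ha (rot f z)
    obtain ⟨x₃, c₃, h₃⟩ := ha (rot u v)
    obtain ⟨x₄, c₄, h₄⟩ := ha (rot w v)
    obtain ⟨d₁, k₁⟩ := hrot e he _ _ _ h₁
    obtain ⟨d₂, k₂⟩ := hrot f hf _ _ _ h₂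
    obtain ⟨d₃, k₃⟩ := hrot u hu _ _ _ h₃
    obtain ⟨d₄, k₄⟩ := hrot w hw _ _ _ h₄
    obtain ⟨d, hd⟩ := htrans (x := x₁ * x₂⁻¹) (y := x₃ * x₄⁻¹) ⟨c₁ * c₂⁻¹ * (c₃ * c₄⁻¹)⁻¹, by
      rw [map_mul, map_inv, h₁, h₂, map_mul a x₃, map_inv, h₃, h₄, phase_mul_rot_mul_inv,
        phase_mul_rot_mul_inv, heq, ← mul_assoc, ← map_mul, inv_mul_cancel_right]⟩
    have htr := congrArg (fun v => ‖unitaryTrace v‖) hd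
    have htr₁ : b (x₁ * x₂⁻¹) = phase F (d₁ * d₂⁻¹) * rotPair (φ e) (φ f) (σ z) := by
      rw [map_mul, map_inv, k₁, k₂, phase_mul_rot_mul_inv]
    have htr₂ : b (x₃ * x₄⁻¹) = phase F (d₃ * d₄⁻¹) * rotPair (φ u) (φ w) (σ v) := by
      rw [map_mul, map_inv, k₃, k₄, phase_mul_rot_mul_inv]
    simp only [htr₁, htr₂] at htr
    rw [norm_unitaryTrace_phase_mul, norm_unitaryTrace_phase_mul, norm_unitaryTrace_phase_mul,
      unitaryTrace_rotPair (hφ e he) (hφ f hf), unitaryTrace_rotPair (hφ u hu) (hφ w hw),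
      hφo u w hu hw huw, Complex.norm_real, Complex.norm_real, Real.norm_eq_abs,
      Real.norm_eq_abs, norm_zero] at htr
    rw [map_pow, circle_re_sq]
    have hN : (2 : ℝ) ≤ Module.finrank ℂ F := by exact_mod_cast hn'
    set N : ℝ := (Module.finrank ℂ F : ℝ)
    set s : ℝ := 1 - (σ z : ℂ).re with hs
    have hs0 : 0 ≤ s := sub_nonneg.2 (circle_re_le_one _)
    have h1 : (σ v : ℂ).re ≤ 1 := circle_re_le_one _
    have h2 : -1 ≤ (σ v : ℂ).re := neg_one_le_circle_re _
    set q := ‖⟪φ e, φ f⟫_ℂ‖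
    have h3 : N - 2 * s ≤ N - 2 * s * (1 - q ^ 2) := by nlinarith [mul_nonneg hs0 (sq_nonneg q)]
    have h4 : N - 2 * s ≤ |N - 2 * (1 - (σ v : ℂ).re) * (1 - 0 ^ 2)| := by
      rw [← htr]; exact h3.trans (le_abs_self _)
    by_cases hs1 : 1 ≤ s
    · nlinarith [sq_nonneg (σ v : ℂ).re]
    · push Not at hs1
      -- The second alternative needs dim F ≥ 2.
      have h5 : 1 - s ≤ (σ v : ℂ).re ∨ 1 - s ≤ -(σ v : ℂ).re := by
        rcases le_abs.1 h4 with h | h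
        · left; linarith
        · right; linarith
      have h6 : (1 - s) ^ 2 ≤ (σ v : ℂ).re ^ 2 := by
        rcases h5 with h | h
        · exact pow_le_pow_left₀ (by linarith) h 2
        · rw [← neg_sq (σ v : ℂ).re]; exact pow_le_pow_left₀ (by linarith) h 2
      nlinarith [sq_nonneg s]
  intro t
  obtain ⟨e, μ, ht⟩ := exists_eq_diagHom (a t)
  have horth : Orthonormal ℂ fun i => φ (e i) :=
    ⟨fun i => hφ _ (e.norm_eq_one i), fun i j hij =>
      hφo _ _ (e.norm_eq_one i) (e.norm_eq_one j) (e.orthonormal.2 hij)⟩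
  let f : OrthonormalBasis (Fin (Module.finrank ℂ E)) ℂ F := OrthonormalBasis.mk horth
    (horth.linearIndependent.span_eq_top_of_card_eq_finrank' (by simpa using hEF)).ge
  have hf (i) : f i = φ (e i) := by simp [f]
  -- Factoring into reflections, an element with eigenvalues `μ i` on `e i` acts on F, up to a
  -- scalar, with eigenvalues `σ (μ i)` on `φ (e i)`.
  have hprod (s : Finset (Fin (Module.finrank ℂ E))) : ∃ x c c',
      a x = phase E c * diagHom e (∏ i ∈ s, Pi.mulSingle i (μ i)) ∧
      b x = phase F c' * diagHom f (∏ i ∈ s, Pi.mulSingle i (σ (μ i))) := by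
    induction s using Finset.induction_on with
    | empty => exact ⟨1, 1, 1, by simp, by simp⟩
    | insert i s hi ih =>
      obtain ⟨x, c, c', h1, h2⟩ := ih
      obtain ⟨y, d, hy⟩ := ha (rot (e i) (μ i))
      obtain ⟨d', hy'⟩ := hrot _ (e.norm_eq_one i) _ _ _ hy
      refine ⟨y * x, d * c, d' * c', ?_, ?_⟩
      · rw [map_mul, hy, h1, Finset.prod_insert hi, map_mul (diagHom e), diagHom_mulSingle, map_mul,
          mul_assoc, ← mul_assoc (rot _ _), ← phase_comm c]
        simp only [mul_assoc]
      · rw [map_mul, hy', h2, Finset.prod_insert hi, map_mul (diagHom f), diagHom_mulSingle, hf,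
          map_mul, mul_assoc, ← mul_assoc (rot _ _), ← phase_comm c']
        simp only [mul_assoc]
  obtain ⟨x, c, c', h1, h2⟩ := hprod Finset.univ
  rw [Finset.univ_prod_mulSingle] at h1
  rw [Finset.univ_prod_mulSingle (fun i => σ (μ i))] at h2
  obtain ⟨d, hd⟩ := htrans (x := t) (y := x)
    ⟨c⁻¹, by rw [ht, h1, ← mul_assoc, ← map_mul, inv_mul_cancel, map_one, one_mul]⟩
  rw [hd, h2, norm_unitaryTrace_phase_mul, norm_unitaryTrace_phase_mul, ht, unitaryTrace_diagHom,
    unitaryTrace_diagHom]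
  rcases circle_endomorphism_classification hσ hcont with h | h
  · simp only [h]
  · simp only [h, Circle.coe_inv_eq_conj, ← map_sum, Complex.norm_conj]

end Rigidity

/-! ### Goursat's lemma for two components -/

section Goursat

variable {E : Type*} [NormedAddCommGroup E] [InnerProductSpace ℂ E] [FiniteDimensional ℂ E]
variable {F : Type*} [NormedAddCommGroup F] [InnerProductSpace ℂ F] [FiniteDimensional ℂ F]
variable {T : Type*} [Group T] {a : T →* (E ≃ₗᵢ[ℂ] E)} {b : T →* (F ≃ₗᵢ[ℂ] F)}

lemma specialUnitary_eq_bot_of_finrank_lt_two (hn : Module.finrank ℂ E < 2) :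
    specialUnitary E = ⊥ := by
  rw [eq_bot_iff]
  refine specialUnitary_le_of_rotPair_mem _ fun u w hu hw huw z => ?_
  have h := (orthonormal_vec_two hu hw huw).linearIndependent.fintype_card_le_finrank
  rw [Fintype.card_fin] at h
  omega

lemma mem_phase_range_of_finrank_lt_two (hn : Module.finrank ℂ E < 2) (v : E ≃ₗᵢ[ℂ] E) :
    v ∈ (phase E).range :=
  mem_phase_range_of_commutator_mem fun s hs => by
    rw [specialUnitary_eq_bot_of_finrank_lt_two hn, Subgroup.mem_bot] at hs
    rw [hs, commutatorElement_one_right]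
    exact one_mem _

lemma exists_eq_phase_mul_of_specialUnitary_le (ha : specialUnitary E ≤ a.range)
    (v : E ≃ₗᵢ[ℂ] E) : ∃ t c, a t = phase E c * v := by
  rcases subsingleton_or_nontrivial E with hE | hE
  · exact ⟨1, 1, LinearIsometryEquiv.ext fun x => Subsingleton.elim _ _⟩
  obtain ⟨c, hc⟩ := exists_phase_mul_mem_specialUnitary v
  obtain ⟨t, ht⟩ := ha hc
  exact ⟨t, c, ht⟩

lemma exists_not_mem_phase_range (hn : 2 ≤ Module.finrank ℂ E) (ha : specialUnitary E ≤ a.range) :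
    ∃ t, a t ∉ (phase E).range := by
  obtain ⟨u, hu⟩ := exists_norm_eq_one_of_two_le hn
  obtain ⟨ζ, hζ, -⟩ := exists_circle_root Nat.prime_two
  obtain ⟨t, c, ht⟩ := exists_eq_phase_mul_of_specialUnitary_le ha (rot u ζ)
  refine ⟨t, fun h => hζ (rot_mem_phase_range hn hu ?_)⟩
  rwa [ht, phase_mul_mem_range_iff] at h

lemma mem_phase_range_of_commutator_map_mem (ha : specialUnitary E ≤ a.range) {t : T}
    (h : ∀ t', a ⁅t, t'⁆ ∈ (phase E).range) : a t ∈ (phase E).range :=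
  mem_phase_range_of_commutator_mem fun s hs => by
    obtain ⟨t', rfl⟩ := ha hs
    rw [← map_commutatorElement]
    exact h t'

/-- If b t is scalar, every commutator of t lies in the kernel of b, so a t commutes modulo scalars
with SU(E) and is scalar. -/
lemma mem_phase_range_of_mem_phase_range (ha : specialUnitary E ≤ a.range)
    (hN : ∀ t, b t = 1 → a t ∈ (phase E).range) {t : T} (h : b t ∈ (phase F).range) :
    a t ∈ (phase E).range :=
  mem_phase_range_of_commutator_map_mem ha fun t' => hN _ (by
    rw [map_commutatorElement]
    exact commutatorElement_eq_one_iff_commute.2 (commute_of_mem_phase_range h _))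

lemma specialUnitary_le_map_ker_of_exists (ha : specialUnitary E ≤ a.range)
    (h : ∃ t, b t = 1 ∧ a t ∉ (phase E).range) : specialUnitary E ≤ b.ker.map a := by
  obtain ⟨t, ht, hts⟩ := h
  refine specialUnitary_le_of_not_mem_phase_range ?_ (x := a t) ⟨t, ht, rfl⟩ hts
  rintro s hs _ ⟨y, hy, rfl⟩
  obtain ⟨r, rfl⟩ := ha hs
  exact ⟨r * y * r⁻¹, b.normal_ker.conj_mem y hy r, by simp⟩

/-- Goursat's lemma for a pair of representations whose images contain the special unitary group. -/
theorem specialUnitary_le_map_ker (ha : specialUnitary E ≤ a.range)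
    (hb : specialUnitary F ≤ b.range)
    (hab : Module.finrank ℂ E = Module.finrank ℂ F → 2 ≤ Module.finrank ℂ E →
      ∃ t, ‖unitaryTrace (a t)‖ ≠ ‖unitaryTrace (b t)‖) :
    specialUnitary E ≤ b.ker.map a := by
  rcases lt_or_ge (Module.finrank ℂ E) 2 with hn | hn
  · rw [specialUnitary_eq_bot_of_finrank_lt_two hn]
    exact bot_le
  by_contra hcon
  have hN : ∀ t, b t = 1 → a t ∈ (phase E).range := by
    by_contra! h
    exact hcon (specialUnitary_le_map_ker_of_exists ha h)
  obtain ⟨t₀, ht₀⟩ := exists_not_mem_phase_range hn ha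
  rcases lt_or_ge (Module.finrank ℂ F) 2 with hn' | hn'
  · exact ht₀ (mem_phase_range_of_mem_phase_range ha hN (mem_phase_range_of_finrank_lt_two hn' _))
  -- Otherwise the kernel of a covers SU(F), and any commutator of `t₀` can be corrected within that
  -- kernel to be trivial under b. Its image under a is then scalar, which makes `a t₀` scalar.
  have hN' : ∀ t, a t = 1 → b t ∈ (phase F).range := by
    by_contra! h
    have hle := specialUnitary_le_map_ker_of_exists hb h
    refine ht₀ (mem_phase_range_of_commutator_map_mem ha fun t' => ?_)
    obtain ⟨y, hy, hyb⟩ := hle (commutator_mem_specialUnitary (b t₀) (b t'))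
    have h1 := hN (⁅t₀, t'⁆ * y⁻¹) (by
      rw [map_mul, map_inv, hyb, map_commutatorElement, mul_inv_cancel])
    rwa [map_mul, map_inv, MonoidHom.mem_ker.1 hy, inv_one, mul_one] at h1
  have hK (t : T) : t ∈ (phase E).range.comap a ↔ b t ∈ (phase F).range :=
    ⟨mem_phase_range_of_mem_phase_range hb hN', mem_phase_range_of_mem_phase_range ha hN⟩
  obtain ⟨hEF, htr⟩ := norm_unitaryTrace_eq_of_same_kernel (K := (phase E).range.comap a)
    (fun t => Iff.rfl) hK (exists_eq_phase_mul_of_specialUnitary_le ha)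
    (exists_eq_phase_mul_of_specialUnitary_le hb) hn hn'
  obtain ⟨t, ht⟩ := hab hEF hn
  exact ht (htr t)

end Goursat

/-! ### Lifting unitaries from multiplicity spaces and recombining components -/

section Isotypic

variable {G : Type*} [Group G] {H : Type*} [NormedAddCommGroup H] [InnerProductSpace ℂ H]
  [FiniteDimensional ℂ H] {U : G →* (H ≃ₗᵢ[ℂ] H)}

lemma linearMap_ext_toLin {A B : H →ₗ[ℂ] H}
    (h : ∀ (l : Irreps U) (f : MultSpace U l) (q : IrrepSpace U l),
      A (f.toLin q) = B (f.toLin q)) : A = B :=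
  LinearMap.ext_on span_toLin_eq_top (by rintro _ ⟨l, f, q, rfl⟩; exact h l f q)

lemma multProj_ext {V W : invariantUnitaries U} (h : ∀ l, multProj U l V = multProj U l W) :
    V = W := by
  apply Subtype.ext
  apply LinearIsometryEquiv.toLinearEquiv_injective
  apply LinearEquiv.toLinearMap_injective
  refine linearMap_ext_toLin (U := U) fun l f q => ?_
  have h1 := congrArg (fun v => (v f).toLin q) (h l)
  rwa [multProj_toLin, multProj_toLin] at h1

lemma adjoint_toLin_toLin {l : Irreps U} (f f' : MultSpace U l) (q : IrrepSpace U l) :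
    LinearMap.adjoint f.toLin (f'.toLin q) = ⟪f, f'⟫_ℂ • q := by
  apply ext_inner_left ℂ
  intro p
  rw [LinearMap.adjoint_inner_right, inner_toLin_toLin, inner_smul_right, mul_comm]

lemma adjoint_toLin_toLin_of_ne {l l' : Irreps U} (hl : l ≠ l') (f : MultSpace U l)
    (f' : MultSpace U l') (q : IrrepSpace U l') :
    LinearMap.adjoint f.toLin (f'.toLin q) = 0 := by
  apply ext_inner_left ℂ
  intro p
  rw [LinearMap.adjoint_inner_right, inner_toLin_eq_zero hl, inner_zero_right]

/-- The linear map acting as `𝟙 ⊗ v` on the isotypic component of `l` and as the identity on the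
other components. -/
def liftLin {l : Irreps U} (v : MultSpace U l ≃ₗᵢ[ℂ] MultSpace U l) : H →ₗ[ℂ] H :=
  LinearMap.id + ∑ i, (v (stdOrthonormalBasis ℂ (MultSpace U l) i) -
      stdOrthonormalBasis ℂ (MultSpace U l) i).toLin ∘ₗ
    LinearMap.adjoint (stdOrthonormalBasis ℂ (MultSpace U l) i).toLin

lemma liftLin_apply {l : Irreps U} (v : MultSpace U l ≃ₗᵢ[ℂ] MultSpace U l) (f : MultSpace U l)
    (q : IrrepSpace U l) : liftLin v (f.toLin q) = (v f).toLin q := by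
  set b := stdOrthonormalBasis ℂ (MultSpace U l)
  -- The adjoint of a basis map extracts the coefficient of `f` along it, so the correction term
  -- adds `v f - f`.
  have h1 : ∑ i, ⟪b i, f⟫_ℂ • (v (b i) - b i) = v f - f := by
    simp only [smul_sub, Finset.sum_sub_distrib, ← map_smul]
    rw [← map_sum, b.sum_repr']
  have h2 := congrArg (fun g => MultSpace.toLin g q) h1
  simp only [map_sum, map_smul, LinearMap.sum_apply, LinearMap.smul_apply] at h2
  simp only [liftLin, LinearMap.add_apply, LinearMap.id_apply, LinearMap.sum_apply,
    LinearMap.comp_apply, adjoint_toLin_toLin, map_smul]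
  rw [h2, map_sub, LinearMap.sub_apply, add_sub_cancel]

lemma liftLin_apply_of_ne {l l' : Irreps U} (hl : l ≠ l')
    (v : MultSpace U l ≃ₗᵢ[ℂ] MultSpace U l) (f : MultSpace U l') (q : IrrepSpace U l') :
    liftLin v (f.toLin q) = f.toLin q := by
  simp only [liftLin, LinearMap.add_apply, LinearMap.id_apply, LinearMap.sum_apply,
    LinearMap.comp_apply, adjoint_toLin_toLin_of_ne hl, map_zero, Finset.sum_const_zero, add_zero]

lemma liftLin_comp {l : Irreps U} (v w : MultSpace U l ≃ₗᵢ[ℂ] MultSpace U l) :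
    liftLin v ∘ₗ liftLin w = liftLin (v * w) := by
  refine linearMap_ext_toLin (U := U) fun l' f q => ?_
  rw [LinearMap.comp_apply]
  rcases eq_or_ne l l' with rfl | hl
  · rw [liftLin_apply, liftLin_apply, liftLin_apply]; rfl
  · rw [liftLin_apply_of_ne hl, liftLin_apply_of_ne hl, liftLin_apply_of_ne hl]

lemma liftLin_one {l : Irreps U} :
    liftLin (1 : MultSpace U l ≃ₗᵢ[ℂ] MultSpace U l) = LinearMap.id := by
  refine linearMap_ext_toLin (U := U) fun l' f q => ?_
  rcases eq_or_ne l l' with rfl | hl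
  · rw [liftLin_apply]; rfl
  · rw [liftLin_apply_of_ne hl]; rfl

lemma inner_liftLin {l : Irreps U} (v : MultSpace U l ≃ₗᵢ[ℂ] MultSpace U l) (x y : H) :
    ⟪liftLin v x, liftLin v y⟫_ℂ = ⟪x, y⟫_ℂ := by
  have h1 (l₁ l₂ : Irreps U) (f₁ : MultSpace U l₁) (f₂ : MultSpace U l₂) (q₁ : IrrepSpace U l₁)
      (q₂ : IrrepSpace U l₂) : ⟪liftLin v (f₁.toLin q₁), liftLin v (f₂.toLin q₂)⟫_ℂ =
        ⟪f₁.toLin q₁, f₂.toLin q₂⟫_ℂ := by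
    rcases eq_or_ne l l₁ with rfl | hl₁
    · rcases eq_or_ne l l₂ with rfl | hl₂
      · rw [liftLin_apply, liftLin_apply, inner_toLin_toLin, inner_toLin_toLin,
          LinearIsometryEquiv.inner_map_map]
      · rw [liftLin_apply, liftLin_apply_of_ne hl₂, inner_toLin_eq_zero hl₂,
          inner_toLin_eq_zero hl₂]
    · rcases eq_or_ne l l₂ with rfl | hl₂
      · rw [liftLin_apply, liftLin_apply_of_ne hl₁, inner_toLin_eq_zero hl₁.symm,
          inner_toLin_eq_zero hl₁.symm]
      · rw [liftLin_apply_of_ne hl₁, liftLin_apply_of_ne hl₂]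
  have h2 : LinearMap.adjoint (liftLin v) ∘ₗ liftLin v = LinearMap.id := by
    refine linearMap_ext_toLin (U := U) fun l₂ f₂ q₂ => ?_
    apply ext_inner_left ℂ
    intro x
    have hx : x ∈ Submodule.span ℂ {x : H | ∃ (l : Irreps U) (f : MultSpace U l)
        (q : IrrepSpace U l), f.toLin q = x} := by
      rw [span_toLin_eq_top]; trivial
    rw [LinearMap.comp_apply, LinearMap.adjoint_inner_right, LinearMap.id_apply]
    induction hx using Submodule.span_induction with
    | mem x hx => obtain ⟨l₁, f₁, q₁, rfl⟩ := hx; exact h1 _ _ _ _ _ _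
    | zero => simp
    | add x y _ _ hx hy => rw [map_add, inner_add_left, hx, hy, inner_add_left]
    | smul c x _ hx => rw [map_smul, inner_smul_left, hx, inner_smul_left]
  rw [← LinearMap.adjoint_inner_right, ← LinearMap.comp_apply, h2, LinearMap.id_apply]

/-- Every unitary of a multiplicity space is the image of an invariant unitary that acts trivially on
the other isotypic components. -/
theorem exists_multProj_eq {l : Irreps U} (v : MultSpace U l ≃ₗᵢ[ℂ] MultSpace U l) :
    ∃ V : invariantUnitaries U, multProj U l V = v ∧ ∀ l', l' ≠ l → multProj U l' V = 1 := by
  let e : H ≃ₗ[ℂ] H := LinearEquiv.ofLinearMap (liftLin v) (liftLin v⁻¹)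
    (by rw [liftLin_comp, mul_inv_cancel, liftLin_one])
    (by rw [liftLin_comp, inv_mul_cancel, liftLin_one])
  let V : H ≃ₗᵢ[ℂ] H := e.isometryOfInner (inner_liftLin v)
  have hV (x : H) : V x = liftLin v x := rfl
  have hinv : V ∈ invariantUnitaries U := by
    intro g
    apply LinearIsometryEquiv.toLinearEquiv_injective
    apply LinearEquiv.toLinearMap_injective
    refine linearMap_ext_toLin (U := U) fun l' f q => ?_
    change liftLin v (U g (f.toLin q)) = U g (liftLin v (f.toLin q))
    rw [← f.toLin_intertwines]
    rcases eq_or_ne l l' with rfl | hl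
    · rw [liftLin_apply, liftLin_apply, MultSpace.toLin_intertwines]
    · rw [liftLin_apply_of_ne hl, liftLin_apply_of_ne hl, MultSpace.toLin_intertwines]
  refine ⟨⟨V, hinv⟩, LinearIsometryEquiv.ext fun f => MultSpace.toLin_injective
    (LinearMap.ext fun q => ?_), fun l' hl => LinearIsometryEquiv.ext fun f =>
      MultSpace.toLin_injective (LinearMap.ext fun q => ?_)⟩
  · rw [multProj_toLin]
    exact liftLin_apply v f q
  · rw [multProj_toLin]
    exact liftLin_apply_of_ne hl.symm v f q

lemma exists_multSpace_toLin_ne_zero (l : Irreps U) :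
    ∃ (f : MultSpace U l) (q : IrrepSpace U l), f.toLin q ≠ 0 := by
  obtain ⟨q, hq⟩ := exists_ne (0 : IrrepSpace U l)
  let f : MultSpace U l := ⟨(irrepSubrep U l).toSubmodule.subtype, fun g => rfl⟩
  exact ⟨f, q, fun h => hq (Subtype.ext h)⟩

instance finite_irreps : Finite (Irreps U) := by
  choose f q h using exists_multSpace_toLin_ne_zero (U := U)
  have hli : LinearIndependent ℂ fun l => (f l).toLin (q l) :=
    linearIndependent_of_ne_zero_of_inner_eq_zero h fun l l' hl =>
      inner_toLin_eq_zero hl _ _ _ _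
  exact hli.finite

/-- The elements of `T` acting trivially on the multiplicity spaces in `s`. -/
def kernelOn (T : Subgroup (invariantUnitaries U)) (s : Set (Irreps U)) :
    Subgroup (invariantUnitaries U) :=
  T ⊓ ⨅ m ∈ s, (multProj U m).ker

lemma mem_kernelOn {T : Subgroup (invariantUnitaries U)} {s : Set (Irreps U)}
    {V : invariantUnitaries U} :
    V ∈ kernelOn T s ↔ V ∈ T ∧ ∀ m ∈ s, multProj U m V = 1 := by
  simp [kernelOn, Subgroup.mem_inf, Subgroup.mem_iInf, MonoidHom.mem_ker]

/-- By perfectness it is enough to reach commutators. -/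
lemma specialUnitary_le_map_of_commutator {l : Irreps U} {N : Subgroup (invariantUnitaries U)}
    (h : ∀ v ∈ specialUnitary (MultSpace U l), ∀ w ∈ specialUnitary (MultSpace U l),
      ∃ V ∈ N, multProj U l V = ⁅v, w⁆) :
    specialUnitary (MultSpace U l) ≤ N.map (multProj U l) :=
  specialUnitary_le_commutator.trans (Subgroup.commutator_le.2 fun v hv w hw => h v hv w hw)

lemma specialUnitary_le_map_kernelOn_commutator (l : Irreps U) :
    specialUnitary (MultSpace U l) ≤
      (kernelOn (commutator (invariantUnitaries U)) {l}ᶜ).map (multProj U l) := by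
  refine specialUnitary_le_map_of_commutator fun v _ w _ => ?_
  obtain ⟨V, hV, hV'⟩ := exists_multProj_eq v
  obtain ⟨W, hW, hW'⟩ := exists_multProj_eq w
  refine ⟨⁅V, W⁆, mem_kernelOn.2 ⟨Subgroup.commutator_mem_commutator (Subgroup.mem_top _)
    (Subgroup.mem_top _), fun m hm => ?_⟩, ?_⟩
  · rw [map_commutatorElement, hV' m hm, commutatorElement_one_left]
  · rw [map_commutatorElement, hV, hW]

/-- Ribet's lemma: pairwise independence implies independence. -/
lemma specialUnitary_le_map_kernelOn {T : Subgroup (invariantUnitaries U)} {l : Irreps U}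
    (hT : specialUnitary (MultSpace U l) ≤ T.map (multProj U l))
    (hpair : ∀ m, m ≠ l → specialUnitary (MultSpace U l) ≤ (kernelOn T {m}).map (multProj U l))
    (s : Finset (Irreps U)) (hs : l ∉ s) :
    specialUnitary (MultSpace U l) ≤ (kernelOn T (s : Set (Irreps U))).map (multProj U l) := by
  classical
  induction s using Finset.induction_on with
  | empty => simpa [kernelOn] using hT
  | insert m s hm ih =>
    rw [Finset.mem_insert, not_or] at hs
    refine specialUnitary_le_map_of_commutator fun v hv w hw => ?_
    obtain ⟨V, hV, rfl⟩ := ih hs.2 hv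
    obtain ⟨W, hW, rfl⟩ := hpair m (Ne.symm hs.1) hw
    rw [SetLike.mem_coe, mem_kernelOn] at hV hW
    -- `V` is trivial on `s` and `W` on `m`, so the commutator is trivial on both.
    refine ⟨⁅V, W⁆, mem_kernelOn.2 ⟨?_, fun k hk => ?_⟩, map_commutatorElement _ _ _⟩
    · rw [commutatorElement_def]
      exact mul_mem (mul_mem (mul_mem hV.1 hW.1) (inv_mem hV.1)) (inv_mem hW.1)
    · rw [map_commutatorElement]
      rcases Finset.mem_insert.1 (Finset.mem_coe.1 hk) with rfl | hk
      · rw [hW.2 k rfl, commutatorElement_one_right]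
      · rw [hV.2 k hk, commutatorElement_one_left]

/-- Each component of a commutator has determinant one, so `T` contains an element with that
component alone; the product over the finitely many components is the commutator itself. -/
lemma commutator_le_of_specialUnitary_le {T : Subgroup (invariantUnitaries U)}
    (h : ∀ l, specialUnitary (MultSpace U l) ≤ (kernelOn T {l}ᶜ).map (multProj U l)) :
    commutator (invariantUnitaries U) ≤ T := by
  classical
  rw [commutator_def, Subgroup.commutator_le]
  intro V _ W _
  have hfin (s : Finset (Irreps U)) : ∃ t ∈ T, (∀ l ∈ s, multProj U l t = multProj U l ⁅V, W⁆) ∧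
      ∀ l ∉ s, multProj U l t = 1 := by
    induction s using Finset.induction_on with
    | empty => exact ⟨1, one_mem _, by simp, fun l _ => map_one _⟩
    | insert m s hm ih =>
      obtain ⟨t, ht, hts, hts'⟩ := ih
      have hmem : multProj U m ⁅V, W⁆ ∈ specialUnitary (MultSpace U m) := by
        rw [map_commutatorElement]
        exact commutator_mem_specialUnitary _ _
      obtain ⟨r, hr, hrm⟩ := h m hmem
      rw [SetLike.mem_coe, mem_kernelOn] at hr
      refine ⟨r * t, mul_mem hr.1 ht, fun l hl => ?_, fun l hl => ?_⟩
      · rcases eq_or_ne l m with rfl | hlm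
        · rw [map_mul, hrm, hts' l hm, mul_one]
        · rw [map_mul, hr.2 l hlm, one_mul, hts l ((Finset.mem_insert.1 hl).resolve_left hlm)]
      · rw [Finset.mem_insert, not_or] at hl
        rw [map_mul, hr.2 l hl.1, one_mul, hts' l hl.2]
  have := Fintype.ofFinite (Irreps U)
  obtain ⟨t, ht, hts, -⟩ := hfin Finset.univ
  rwa [← multProj_ext fun l => hts l (Finset.mem_univ l)]

/-- An orthogonal pair with eigenvalues i and -i lowers the trace from dim to dim - 2. -/
lemma exists_norm_unitaryTrace_ne {E : Type*} [NormedAddCommGroup E] [InnerProductSpace ℂ E]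
    [FiniteDimensional ℂ E] (hn : 2 ≤ Module.finrank ℂ E) :
    ∃ v ∈ specialUnitary E, ‖unitaryTrace v‖ ≠ Module.finrank ℂ E := by
  obtain ⟨u, hu⟩ := exists_norm_eq_one_of_two_le hn
  obtain ⟨w, hw, huw⟩ := exists_unit_inner_eq_zero hn hu
  obtain ⟨z, hz⟩ := exists_circle_re_eq (r := 0) (by norm_num) (by norm_num)
  refine ⟨rotPair u w z, rotPair_mem_specialUnitary hu hw z, ?_⟩
  have hn' : (2 : ℝ) ≤ Module.finrank ℂ E := by exact_mod_cast hn
  rw [unitaryTrace_rotPair hu hw, huw, hz, Complex.norm_real, Real.norm_eq_abs, norm_zero,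
    abs_of_nonneg (by linarith)]
  linarith

lemma unitaryTrace_one {E : Type*} [NormedAddCommGroup E] [InnerProductSpace ℂ E]
    [FiniteDimensional ℂ E] : unitaryTrace (1 : E ≃ₗᵢ[ℂ] E) = Module.finrank ℂ E :=
  LinearMap.trace_id ℂ E

end Isotypic

end SymmetricUnitaries

end

/-! ### The criterion -/

theorem lemma1 {G : Type*} [Group G] {H : Type*} [NormedAddCommGroup H] [InnerProductSpace ℂ H]
    [FiniteDimensional ℂ H] (U : G →* (H ≃ₗᵢ[ℂ] H))
    (T : Subgroup (SymmetricUnitaries.invariantUnitaries U)) :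
    commutator (SymmetricUnitaries.invariantUnitaries U) ≤ T ↔
      (∀ l : SymmetricUnitaries.Irreps U,
        SymmetricUnitaries.specialUnitary (SymmetricUnitaries.MultSpace U l) ≤
          T.map (SymmetricUnitaries.multProj U l)) ∧
      (∀ l₁ l₂ : SymmetricUnitaries.Irreps U, l₁ ≠ l₂ →
        Module.finrank ℂ (SymmetricUnitaries.MultSpace U l₁) =
          Module.finrank ℂ (SymmetricUnitaries.MultSpace U l₂) →
        2 ≤ Module.finrank ℂ (SymmetricUnitaries.MultSpace U l₁) →
        ∃ V ∈ T, ‖SymmetricUnitaries.unitaryTrace (SymmetricUnitaries.multProj U l₁ V)‖ ≠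
          ‖SymmetricUnitaries.unitaryTrace (SymmetricUnitaries.multProj U l₂ V)‖) := by
  open SymmetricUnitaries in
  constructor
  · intro hT
    refine ⟨fun l s hs => ?_, fun l₁ l₂ hl hdim hn => ?_⟩
    · obtain ⟨V, hV, hVs⟩ := specialUnitary_le_map_kernelOn_commutator l hs
      exact ⟨V, hT (mem_kernelOn.1 hV).1, hVs⟩
    -- An element trivial on `l₁` has trace of modulus dim there, so any other modulus on `l₂`
    -- separates the two.
    · obtain ⟨v, hv, hne⟩ := exists_norm_unitaryTrace_ne (hdim ▸ hn)
      obtain ⟨V, hV, rfl⟩ := specialUnitary_le_map_kernelOn_commutator l₂ hv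
      rw [SetLike.mem_coe, mem_kernelOn] at hV
      refine ⟨V, hT hV.1, ?_⟩
      rw [hV.2 l₁ hl, unitaryTrace_one, hdim, Complex.norm_natCast]
      exact hne.symm
  · rintro ⟨hA, hB⟩
    have hrange (l : Irreps U) :
        specialUnitary (MultSpace U l) ≤ ((multProj U l).comp T.subtype).range := by
      rw [MonoidHom.range_comp, T.range_subtype]
      exact hA l
    have := Fintype.ofFinite (Irreps U)
    classical
    refine commutator_le_of_specialUnitary_le fun l => ?_
    have h := specialUnitary_le_map_kernelOn (hA l) (fun m hm => ?_) (Finset.univ.erase l)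
      (Finset.notMem_erase l _)
    · rwa [Finset.coe_erase, Finset.coe_univ, ← Set.compl_eq_univ_sdiff] at h
    -- Goursat's lemma for `l` and `m` applied to the restrictions to `T`, with B supplying the
    -- element that separates traces.
    · refine (specialUnitary_le_map_ker (hrange l) (hrange m) fun hdim hn => ?_).trans ?_
      · obtain ⟨V, hV, hne⟩ := hB l m hm.symm hdim hn
        exact ⟨⟨V, hV⟩, hne⟩
      · rintro _ ⟨t, ht, rfl⟩
        exact ⟨t, mem_kernelOn.2 ⟨t.2, fun k hk => by rw [Set.mem_singleton_iff.1 hk]; exact ht⟩,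
          rfl⟩
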